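/- Let $n,d\ge 3$, let $S=\mathbb{C}[x_0,\dots,x_n]$ with its standard grading, and let $f\in S$ be a nonzero homogeneous polynomial of degree $d$, defining the hypersurface $V(f):f=0$ in $\mathbb{P}^n$ with singular set $V_s$ (the points of $V(f)$ where all first order partial derivatives of $f$ vanish). Let $J(f)\subset S$ be the ideal generated by the partial derivatives of $f$, let $I(f)$ be the saturation of $J(f)$ with respect to the maximal ideal $(x_0,\dots,x_n)$, and let $N(f)=I(f)/J(f)$ be the Jacobian module, a graded $S$-module with homogeneous components $N(f)_k$. Let $\ell\in S$ be a nonzero linear form and $H:\ell=0$ the corresponding hyperplane. Assume that $H\cap V_s=\emptyset$ and that the hyperplane section $V(f,\ell)=V(f)\cap H$ is singular. Choose linear coordinates $y_1,\dots,y_n$ on $H\cong\mathbb{P}^{n-1}$, and let $g\in R=\mathbb{C}[y_1,\dots,y_n]$ be the restriction of $f$ to $H$, so that $V(f,\ell)$ is the hypersurface $g=0$ in $H$; "singular" means that all the partial derivatives $g_j=\partial g/\partial y_j$ vanish at some point of this hypersurface. Let $I(g)\subset R$ be the saturation of $J(g)=(g_1,\dots,g_n)$ with respect to $(y_1,\dots,y_n)$,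 and let $\mathrm{Syz}(g)=\{(a_1,\dots,a_n)\in R^n : a_1g_1+\dots+a_ng_n=0\}$, whose component $\mathrm{Syz}(g)_j$ consists of the syzygies with all $a_i$ homogeneous of degree $j$. Put $$s(g)=\min\{j\in\mathbb{N} : I(g)_j\neq 0\},\qquad r(g)=\min\{j\in\mathbb{N} : \mathrm{Syz}(g)_j\neq 0\},$$ $$k_0=\min\{d-3+r(g),\; d-3+s(g)\}.$$ Then the multiplication map $\ell: N(f)_k\to N(f)_{k+1}$ is injective for every integer $k$ with $0\le k\le k_0$, and it is surjective for every integer $k\ge (n+1)(d-2)-k_0$. -/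

import Mathlib

open MvPolynomial
open scoped LinearAlgebra.Projectivization

noncomputable section

namespace JacobianModule

variable {m : ℕ}

/-- The Jacobian ideal `J(f)`, generated by the first order partial derivatives of `f`. -/
def jacobianIdeal (f : MvPolynomial (Fin m) ℂ) : Ideal (MvPolynomial (Fin m) ℂ) :=
  Ideal.span (Set.range fun i => pderiv i f)

/-- The maximal homogeneous ideal, generated by all the variables. -/
def irrelevantIdeal (m : ℕ) : Ideal (MvPolynomial (Fin m) ℂ) :=
  Ideal.span (Set.range X)

/-- The saturation `⋃ N, (J : 𝔪 ^ N)` of an ideal `J` with respect to the ideal `𝔪` generated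
by all the variables. -/
def saturation (J : Ideal (MvPolynomial (Fin m) ℂ)) : Ideal (MvPolynomial (Fin m) ℂ) :=
  ⨆ N : ℕ, J.colon ((irrelevantIdeal m ^ N : Ideal (MvPolynomial (Fin m) ℂ)) :
    Set (MvPolynomial (Fin m) ℂ))

/-- The saturation `I(f)` of the Jacobian ideal. -/
def saturatedJacobianIdeal (f : MvPolynomial (Fin m) ℂ) : Ideal (MvPolynomial (Fin m) ℂ) :=
  saturation (jacobianIdeal f)

/-- The union defining the saturation is increasing, so that membership is as expected. -/
theorem mem_saturation_iff (J : Ideal (MvPolynomial (Fin m) ℂ)) (q : MvPolynomial (Fin m) ℂ) :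
    q ∈ saturation J ↔ ∃ N : ℕ, ∀ p ∈ irrelevantIdeal m ^ N, q * p ∈ J := by
  unfold saturation
  rw [Submodule.mem_iSup_of_directed]
  · simp [Submodule.mem_colon]
  · refine directed_of_isDirected_le ?_
    intro a b hab q hq
    rw [Submodule.mem_colon] at hq ⊢
    exact fun p hp => hq p (Ideal.pow_le_pow_right hab hp)

/-- The Jacobian module `N(f) = I(f) / J(f)`, a module over the polynomial ring. -/
abbrev N (f : MvPolynomial (Fin m) ℂ) : Type :=
  saturatedJacobianIdeal f ⧸ (jacobianIdeal f).submoduleOf (saturatedJacobianIdeal f)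

/-- The graded piece `N(f)_k`: the classes of the homogeneous elements of degree `k` of `I(f)`. -/
def piece (f : MvPolynomial (Fin m) ℂ) (k : ℕ) : Submodule ℂ (N f) :=
  ((homogeneousSubmodule (Fin m) ℂ k).comap
    ((saturatedJacobianIdeal f).subtype.restrictScalars ℂ)).map
    (((jacobianIdeal f).submoduleOf (saturatedJacobianIdeal f)).mkQ.restrictScalars ℂ)

/-- The linear form `∑ i, ℓ(e_i) x_i` attached to a linear functional `ℓ`. -/
def linearForm (ℓ : Module.Dual ℂ (Fin m → ℂ)) : MvPolynomial (Fin m) ℂ :=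
  ∑ i, C (ℓ (Pi.single i 1)) * X i

theorem linearForm_isHomogeneous (ℓ : Module.Dual ℂ (Fin m → ℂ)) :
    (linearForm ℓ).IsHomogeneous 1 := by
  refine IsHomogeneous.sum _ _ _ fun i _ => ?_
  simpa using (isHomogeneous_C (Fin m) (ℓ (Pi.single i 1))).mul (isHomogeneous_X ℂ i)

theorem eval_linearForm (ℓ : Module.Dual ℂ (Fin m → ℂ)) (v : Fin m → ℂ) :
    eval v (linearForm ℓ) = ℓ v := by
  conv_rhs => rw [LinearMap.pi_apply_eq_sum_univ ℓ v]
  simp only [linearForm, map_sum, map_mul, eval_C, eval_X, smul_eq_mul]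
  refine Finset.sum_congr rfl fun i _ => ?_
  rw [mul_comm]
  congr 2
  ext j
  simp [Pi.single_apply, eq_comm]

theorem smul_mem_piece (f : MvPolynomial (Fin m) ℂ) (ℓ : Module.Dual ℂ (Fin m → ℂ)) (k : ℕ)
    (z : N f) (hz : z ∈ piece f k) :
    Algebra.lsmul ℂ ℂ (N f) (linearForm ℓ) z ∈ piece f (k + 1) := by
  obtain ⟨q, hq, rfl⟩ := hz
  refine ⟨linearForm ℓ • q, ?_, rfl⟩
  have h := (linearForm_isHomogeneous ℓ).mul (show (q : MvPolynomial (Fin m) ℂ).IsHomogeneous k from hq)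
  rw [add_comm] at h
  exact h

/-- The multiplication map `ℓ : N(f)_k → N(f)_{k+1}`. -/
def mulMap (f : MvPolynomial (Fin m) ℂ) (ℓ : Module.Dual ℂ (Fin m → ℂ)) (k : ℕ) :
    piece f k →ₗ[ℂ] piece f (k + 1) :=
  (Algebra.lsmul ℂ ℂ (N f) (linearForm ℓ)).restrict (smul_mem_piece f ℓ k)

/-- The singular points of the projective hypersurface `f = 0`, for `f` homogeneous: the points
of the hypersurface at which all the partial derivatives of `f` vanish. As `f` and its partial
derivatives are homogeneous, the choice of homogeneous coordinates of `p` does not matter. -/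
def singularLocus (f : MvPolynomial (Fin m) ℂ) : Set (ℙ ℂ (Fin m → ℂ)) :=
  {p | eval p.rep f = 0 ∧ ∀ i, eval p.rep (pderiv i f) = 0}

/-- The projective hyperplane `ℓ = 0`. -/
def hyperplane (ℓ : Module.Dual ℂ (Fin m → ℂ)) : Set (ℙ ℂ (Fin m → ℂ)) :=
  {p | ℓ p.rep = 0}

/-- The equation of the section of `f = 0` by the hyperplane `ℓ = 0`, in the linear
coordinates `y` on this hyperplane given by a basis `b` of the kernel of `ℓ`:
`g(y) = f(∑ j, y_j b_j)`. -/
def hyperplaneSection {n : ℕ} (f : MvPolynomial (Fin m) ℂ) (ℓ : Module.Dual ℂ (Fin m → ℂ))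
    (b : Module.Basis (Fin n) ℂ (LinearMap.ker ℓ)) : MvPolynomial (Fin n) ℂ :=
  aeval (fun i => ∑ j, C ((b j : Fin m → ℂ) i) * X j) f

/-- The module `Syz(g)` of first order syzygies of the partial derivatives of `g`. -/
def syz (g : MvPolynomial (Fin m) ℂ) :
    Submodule (MvPolynomial (Fin m) ℂ) (Fin m → MvPolynomial (Fin m) ℂ) :=
  LinearMap.ker (Fintype.linearCombination (MvPolynomial (Fin m) ℂ) fun i => pderiv i g)

theorem mem_syz_iff (g : MvPolynomial (Fin m) ℂ) (a : Fin m → MvPolynomial (Fin m) ℂ) :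
    a ∈ syz g ↔ ∑ i, a i * pderiv i g = 0 := by
  simp [syz, Fintype.linearCombination_apply]

/-- The initial degree `s(g)` of the graded ideal `I(g)`. -/
def s (g : MvPolynomial (Fin m) ℂ) : ℕ :=
  sInf {j | ∃ p ∈ saturatedJacobianIdeal g, p.IsHomogeneous j ∧ p ≠ 0}

/-- The initial degree `r(g)` of the graded module `Syz(g)`, where a syzygy has degree `j` if all
its components are homogeneous of degree `j`. -/
def r (g : MvPolynomial (Fin m) ℂ) : ℕ :=
  sInf {j | ∃ a ∈ syz g, (∀ i, (a i).IsHomogeneous j) ∧ a ≠ 0}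

end JacobianModule

end

namespace JacobianModule

attribute [local instance] MvPolynomial.gradedAlgebra

/-! ### Regular elements and socle generators modulo an ideal. -/

section Ideals

variable {R : Type*} [CommRing R]

/-! Injectivity holds on all of S/J(f). Choose v with ℓ(v) = 1 and write ℓp = a₀ f_v + Σ a_j
f_{b_j}. Restricting to H gives 0 = a₀| f_v| + Σ a_j| g_j. Since H misses V_s, the form f_v| and the
g_j have no common zero except 0, so a₀| f_v| ∈ J(g) forces a₀| ∈ I(g). The degree bounds then kill
a₀| (by s(g)) and the remaining syzygy (a_j|) (by r(g)). Hence ℓ divides every a_j and can be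
cancelled. This is `mem_jacobianIdeal_of_linearForm_mul_mem`.

Surjectivity comes from injectivity by duality, applied on H rather than to N(f). After a linear
change of the partials, J(f) = Q + (p), where Q has n generators whose restrictions are a system of
parameters of R (`exists_isParameterSystem_sub`). The quotient R/Q| is Gorenstein with socle degree
n(d-2), so (p|) is its own double annihilator there. For c in I(f), this reduces c ∈ J(f) + (ℓ) to a
statement about those u with p|u ∈ Q|, and injectivity in the complementary degree settles it. This
is `exists_sub_linearForm_mul_mem`.

The Gorenstein property (`IsParameterSystem.isGorensteinFamily`) is obtained by exchange: starting
from the variables, where everything is visible, the members of the family are replaced one at a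
time, passing through general linear forms. -/

theorem mem_sup_span_singleton_iff {V : Ideal R} {p x : R} :
    x ∈ V ⊔ Ideal.span {p} ↔ ∃ c, x - p * c ∈ V := by
  rw [Submodule.mem_sup]
  constructor
  · rintro ⟨v, hv, z, hz, rfl⟩
    obtain ⟨c, rfl⟩ := Ideal.mem_span_singleton'.1 hz
    exact ⟨c, by convert hv using 1; ring⟩
  · rintro ⟨c, hc⟩
    exact ⟨_, hc, p * c, Ideal.mem_span_singleton'.2 ⟨c, mul_comm _ _⟩, by ring⟩

/-- `a` is a nonzerodivisor modulo `V`. -/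
def IsRegularMod (V : Ideal R) (a : R) : Prop := ∀ x, a * x ∈ V → x ∈ V

theorem IsRegularMod.pow {V : Ideal R} {a : R} (h : IsRegularMod V a) (k : ℕ) :
    IsRegularMod V (a ^ k) := by
  induction k with
  | zero => intro x hx; simpa using hx
  | succ k ih => exact fun x hx => h x (ih _ (by rwa [← mul_assoc, ← pow_succ]))

theorem IsRegularMod.swap {V : Ideal R} {w p : R} (hw : IsRegularMod V w)
    (hp : IsRegularMod (V ⊔ Ideal.span {w}) p) : IsRegularMod (V ⊔ Ideal.span {p}) w := by
  intro x hx
  obtain ⟨y, hy⟩ := mem_sup_span_singleton_iff.1 hx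
  have h1 : y ∈ V ⊔ Ideal.span {w} := by
    refine hp y (mem_sup_span_singleton_iff.2 ⟨x, ?_⟩)
    have := V.neg_mem hy
    convert this using 1; ring
  obtain ⟨c, hc⟩ := mem_sup_span_singleton_iff.1 h1
  refine mem_sup_span_singleton_iff.2 ⟨c, hw _ ?_⟩
  have := V.add_mem hy (V.mul_mem_left p hc)
  convert this using 1; ring

/-- Every ideal strictly containing `I` contains `s ∉ I`: the class of `s` generates the socle of
`R ⧸ I`, and `I` is irreducible. -/
def IsSocleGenerator (I : Ideal R) (s : R) : Prop :=
  s ∉ I ∧ ∀ x, x ∉ I → s ∈ I ⊔ Ideal.span {x}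

/-- Multiply x by t until just before it dies modulo U + (t^(k+1)). Regularity of t then shows that
it has become t^k c with c ∉ U + (t), and s is a multiple of c modulo U + (t). -/
theorem IsSocleGenerator.mul_pow {U : Ideal R} {t s : R}
    (hs : IsSocleGenerator (U ⊔ Ideal.span {t}) s) (ht : IsRegularMod U t) (k : ℕ) :
    IsSocleGenerator (U ⊔ Ideal.span {t ^ (k + 1)}) (t ^ k * s) := by
  refine ⟨fun h => hs.1 ?_, fun x hx => ?_⟩
  · obtain ⟨c, hc⟩ := mem_sup_span_singleton_iff.1 h
    refine mem_sup_span_singleton_iff.2 ⟨c, ht.pow k _ ?_⟩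
    convert hc using 1; ring
  · classical
    have hex : ∃ j, t ^ j * x ∈ U ⊔ Ideal.span {t ^ (k + 1)} :=
      ⟨k + 1, mem_sup_span_singleton_iff.2 ⟨x, by simp⟩⟩
    obtain ⟨j, hj⟩ : ∃ j, Nat.find hex = j + 1 := by
      refine Nat.exists_eq_succ_of_ne_zero fun h0 => hx ?_
      simpa [h0] using Nat.find_spec hex
    have h1 := Nat.find_spec hex
    have h2 := Nat.find_min hex (m := j) (by omega)
    rw [hj] at h1
    obtain ⟨c, hc⟩ := mem_sup_span_singleton_iff.1 h1
    have h3 : t ^ j * x - t ^ k * c ∈ U := ht _ (by convert hc using 1; ring)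
    have h4 : c ∉ U ⊔ Ideal.span {t} := by
      intro h
      obtain ⟨y, hy⟩ := mem_sup_span_singleton_iff.1 h
      refine h2 (mem_sup_span_singleton_iff.2 ⟨y, ?_⟩)
      have := U.add_mem h3 (U.mul_mem_left (t ^ k) hy)
      convert this using 1; ring
    obtain ⟨y, hy⟩ := mem_sup_span_singleton_iff.1 (hs.2 c h4)
    obtain ⟨z, hz⟩ := mem_sup_span_singleton_iff.1 hy
    refine mem_sup_span_singleton_iff.2 ⟨t ^ j * y, mem_sup_span_singleton_iff.2 ⟨z, ?_⟩⟩
    have := U.sub_mem (U.mul_mem_left (t ^ k) hz) (U.mul_mem_left y h3)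
    convert this using 1; ring

/-- Multiplication by a embeds R/(U + (p)) in R/(U + (ap)), so a socle generator divisible by a
pulls back. -/
theorem IsSocleGenerator.of_mul {U : Ideal R} {a p s y : R} (ha : IsRegularMod U a)
    (hs : IsSocleGenerator (U ⊔ Ideal.span {a * p}) s)
    (hy : s - a * y ∈ U ⊔ Ideal.span {a * p}) : IsSocleGenerator (U ⊔ Ideal.span {p}) y := by
  obtain ⟨e, he⟩ := mem_sup_span_singleton_iff.1 hy
  refine ⟨fun h => hs.1 ?_, fun x hx => ?_⟩
  · obtain ⟨c, hc⟩ := mem_sup_span_singleton_iff.1 h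
    refine mem_sup_span_singleton_iff.2 ⟨c + e, ?_⟩
    have := U.add_mem he (U.mul_mem_left a hc)
    convert this using 1; ring
  · have h1 : a * x ∉ U ⊔ Ideal.span {a * p} := by
      intro h
      obtain ⟨c, hc⟩ := mem_sup_span_singleton_iff.1 h
      exact hx (mem_sup_span_singleton_iff.2 ⟨c, ha _ (by convert hc using 1; ring)⟩)
    obtain ⟨z, hz⟩ := mem_sup_span_singleton_iff.1 (hs.2 _ h1)
    obtain ⟨c, hc⟩ := mem_sup_span_singleton_iff.1 hz
    refine mem_sup_span_singleton_iff.2 ⟨z, mem_sup_span_singleton_iff.2 ⟨c - e, ha _ ?_⟩⟩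
    have := U.sub_mem hc he
    convert this using 1; ring

end Ideals

/-! ### Homogeneous ideals: graded Krull intersection, minimal primes, avoidance. -/

section Graded

variable {σ K : Type*} [Field K]

theorem homogeneousComponent_add_mul {q : MvPolynomial σ K} {e : ℕ} (hq : q.IsHomogeneous e)
    (a : MvPolynomial σ K) (k : ℕ) :
    homogeneousComponent (k + e) (a * q) = homogeneousComponent k a * q := by
  conv_lhs => rw [← sum_homogeneousComponent a]
  rw [Finset.sum_mul, map_sum]
  have h : ∀ i, homogeneousComponent (k + e) (homogeneousComponent i a * q) =
      if k = i then homogeneousComponent i a * q else 0 := by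
    intro i
    rw [homogeneousComponent_of_mem ((homogeneousComponent_isHomogeneous i a).mul hq)]
    simp
  simp only [h, Finset.sum_ite_eq]
  split_ifs with hk
  · rfl
  · rw [homogeneousComponent_eq_zero k a (by simpa using hk), zero_mul]

theorem homogeneousComponent_mul_of_lt {q : MvPolynomial σ K} {e : ℕ} (hq : q.IsHomogeneous e)
    (a : MvPolynomial σ K) {k : ℕ} (hk : k < e) : homogeneousComponent k (a * q) = 0 := by
  conv_lhs => rw [← sum_homogeneousComponent a]
  rw [Finset.sum_mul, map_sum]
  refine Finset.sum_eq_zero fun i _ => ?_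
  rw [homogeneousComponent_of_mem ((homogeneousComponent_isHomogeneous i a).mul hq), if_neg]
  omega

theorem mem_idealOfVars_pow_of_isHomogeneous {x : MvPolynomial σ K} {k N : ℕ}
    (hx : x.IsHomogeneous k) (h : N ≤ k) : x ∈ idealOfVars σ K ^ N := by
  rw [mem_pow_idealOfVars_iff']
  intro m hm
  by_contra h0
  have : m.degree = k := by
    rw [Finsupp.degree_eq_weight_one]
    exact hx h0
  omega

theorem homogeneousComponent_eq_zero_of_mem {x : MvPolynomial σ K} {k N : ℕ}
    (hx : x ∈ idealOfVars σ K ^ N) (h : k < N) : homogeneousComponent k x = 0 := by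
  ext m
  rw [coeff_homogeneousComponent, coeff_zero]
  split_ifs with hm
  · exact (mem_pow_idealOfVars_iff' N x).1 hx m (by omega)
  · rfl

theorem mem_of_forall_mem_sup_pow {V : Ideal (MvPolynomial σ K)}
    (hV : V.IsHomogeneous (homogeneousSubmodule σ K)) {x : MvPolynomial σ K}
    (h : ∀ N, x ∈ V ⊔ idealOfVars σ K ^ N) : x ∈ V := by
  rw [mem_iff_homogeneousComponent_mem hV]
  intro k
  obtain ⟨v, hv, z, hz, rfl⟩ := Submodule.mem_sup.1 (h (k + 1))
  rw [map_add, homogeneousComponent_eq_zero_of_mem hz k.lt_succ_self, add_zero]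
  exact homogeneousComponent_mem_of_mem hV hv k

theorem isHomogeneous_span {s : Set (MvPolynomial σ K)} (h : ∀ x ∈ s, ∃ k, x.IsHomogeneous k) :
    (Ideal.span s).IsHomogeneous (homogeneousSubmodule σ K) :=
  Ideal.homogeneous_span _ _ h

theorem isHomogeneous_sup_span_singleton {V : Ideal (MvPolynomial σ K)}
    (hV : V.IsHomogeneous (homogeneousSubmodule σ K)) {p : MvPolynomial σ K} {e : ℕ}
    (hp : p.IsHomogeneous e) :
    (V ⊔ Ideal.span {p}).IsHomogeneous (homogeneousSubmodule σ K) :=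
  hV.sup (isHomogeneous_span (by rintro _ rfl; exact ⟨e, hp⟩))

/-- If px ∈ V, then x ≡ wy mod V, and regularity of w gives py ∈ V again. Iterating puts x in V +
𝔪^N for every N, hence in V. -/
theorem IsRegularMod.of_sup {V : Ideal (MvPolynomial σ K)}
    (hV : V.IsHomogeneous (homogeneousSubmodule σ K)) {w p : MvPolynomial σ K}
    (hwm : w ∈ idealOfVars σ K) (hw : IsRegularMod V w)
    (hp : IsRegularMod (V ⊔ Ideal.span {w}) p) : IsRegularMod V p := by
  have key : ∀ N x, p * x ∈ V → x ∈ V ⊔ idealOfVars σ K ^ N := by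
    intro N
    induction N with
    | zero => intro x _; simp
    | succ N ih =>
      intro x hx
      obtain ⟨y, hy⟩ := mem_sup_span_singleton_iff.1 (hp x (Ideal.mem_sup_left hx))
      have h1 : p * y ∈ V := by
        refine hw _ ?_
        have := V.sub_mem hx (V.mul_mem_left p hy)
        convert this using 1; ring
      obtain ⟨v, hv, z, hz, rfl⟩ := Submodule.mem_sup.1 (ih y h1)
      refine Submodule.mem_sup.2
        ⟨x - w * (v + z) + w * v, V.add_mem hy (V.mul_mem_left _ hv), w * z, ?_, by ring⟩
      rw [pow_succ']
      exact Ideal.mul_mem_mul hwm hz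
  exact fun x hx => mem_of_forall_mem_sup_pow hV fun N => key N x hx

theorem le_idealOfVars_of_isHomogeneous {p : Ideal (MvPolynomial σ K)}
    (hp : p.IsHomogeneous (homogeneousSubmodule σ K)) (htop : p ≠ ⊤) : p ≤ idealOfVars σ K := by
  intro x hx
  rw [← pow_one (idealOfVars σ K), mem_pow_idealOfVars_iff']
  intro m hm
  obtain rfl : m = 0 := by
    rw [← Finsupp.degree_eq_zero_iff]; omega
  by_contra h0
  have h1 := homogeneousComponent_mem_of_mem hp hx 0
  rw [homogeneousComponent_zero] at h1
  exact htop (Ideal.eq_top_of_isUnit_mem _ h1 ((isUnit_iff_ne_zero.2 h0).map C))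

theorem isHomogeneous_of_mem_minimalPrimes {I p : Ideal (MvPolynomial σ K)}
    (hI : I.IsHomogeneous (homogeneousSubmodule σ K)) (hp : p ∈ I.minimalPrimes) :
    p.IsHomogeneous (homogeneousSubmodule σ K) := by
  have h1 := hp.1.1.homogeneousCore (𝒜 := homogeneousSubmodule σ K)
  have h2 : I ≤ (p.homogeneousCore (homogeneousSubmodule σ K)).toIdeal := by
    rw [← hI.toIdeal_homogeneousCore_eq_self]
    exact Ideal.homogeneousCore_mono _ hp.1.2
  have h3 := hp.2 ⟨h1, h2⟩ (Ideal.toIdeal_homogeneousCore_le _ p)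
  rw [le_antisymm h3 (Ideal.toIdeal_homogeneousCore_le _ p)]
  exact HomogeneousIdeal.isHomogeneous _

/-- A vector space over an infinite field is not a finite union of proper subspaces. -/
theorem exists_linear_notMem [Infinite K] [Finite σ] {P : Set (Ideal (MvPolynomial σ K))}
    (hP : P.Finite) :
    ∃ z : MvPolynomial σ K, z.IsHomogeneous 1 ∧ ∀ p ∈ P, ¬ idealOfVars σ K ≤ p → z ∉ p := by
  classical
  let E := homogeneousSubmodule σ K 1
  let sub : Ideal (MvPolynomial σ K) → Subspace K E := fun p =>
    (p.restrictScalars K).comap E.subtype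
  have hP' : {p | p ∈ P ∧ ¬ idealOfVars σ K ≤ p}.Finite := hP.subset fun _ h => h.1
  have htop : ⊤ ∉ hP'.toFinset.image sub := by
    simp only [Finset.mem_image, Set.Finite.mem_toFinset, Set.mem_ofPred_eq, not_exists, not_and]
    rintro p ⟨-, hp⟩ h
    apply hp
    rw [idealOfVars, Ideal.span_le]
    rintro _ ⟨i, rfl⟩
    have : (⟨X i, isHomogeneous_X K i⟩ : E) ∈ sub p := h ▸ Submodule.mem_top
    exact this
  have := Subspace.biUnion_ne_univ_of_top_notMem htop
  obtain ⟨z, hz⟩ := (Set.ne_univ_iff_exists_notMem _).1 this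
  refine ⟨z, z.2, fun p hp hpm hzp => hz ?_⟩
  simp only [Set.mem_iUnion]
  refine ⟨sub p, ?_, hzp⟩
  exact Finset.mem_image_of_mem _ (hP'.mem_toFinset.2 ⟨hp, hpm⟩)

end Graded

/-! ### Parameter systems are regular in any order and have a simple socle. -/

section ParameterSystems

variable {σ K : Type*} [Field K]

/-- A homogeneous system of parameters of `K[σ]`, with degrees `d`. -/
structure IsParameterSystem (d : σ → ℕ) (q : σ → MvPolynomial σ K) : Prop where
  pos : ∀ i, 0 < d i
  isHomogeneous : ∀ i, (q i).IsHomogeneous (d i)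
  exists_pow_le : ∃ N, idealOfVars σ K ^ N ≤ Ideal.span (Set.range q)

/-- Every member of the family is a nonzerodivisor modulo any of the others. -/
def IsRegularFamily (q : σ → MvPolynomial σ K) : Prop :=
  ∀ (T : Set σ) (i : σ), i ∉ T → IsRegularMod (Ideal.span (q '' T)) (q i)

/-- A regular family whose quotient has a simple socle, in the expected degree. -/
structure IsGorensteinFamily [Fintype σ] (d : σ → ℕ) (q : σ → MvPolynomial σ K) : Prop where
  regular : IsRegularFamily q
  exists_socle : ∃ s : MvPolynomial σ K, s.IsHomogeneous (∑ i, (d i - 1)) ∧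
    IsSocleGenerator (Ideal.span (Set.range q)) s

theorem span_image_insert (q : σ → MvPolynomial σ K) (T : Set σ) (i : σ) :
    Ideal.span (q '' insert i T) = Ideal.span (q '' T) ⊔ Ideal.span {q i} := by
  rw [Set.image_insert_eq, Set.insert_eq, Ideal.span_union, sup_comm]

theorem span_range_eq_sup (q : σ → MvPolynomial σ K) (i : σ) :
    Ideal.span (Set.range q) = Ideal.span (q '' {i}ᶜ) ⊔ Ideal.span {q i} := by
  rw [← span_image_insert, ← Set.image_univ]
  congr 2
  ext j
  simpa using em (j = i)

theorem IsParameterSystem.isHomogeneous_span_image {d : σ → ℕ} {q : σ → MvPolynomial σ K}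
    (hq : IsParameterSystem d q) (T : Set σ) :
    (Ideal.span (q '' T)).IsHomogeneous (homogeneousSubmodule σ K) :=
  isHomogeneous_span (by rintro _ ⟨i, -, rfl⟩; exact ⟨_, hq.isHomogeneous i⟩)

theorem IsParameterSystem.mem_idealOfVars {d : σ → ℕ} {q : σ → MvPolynomial σ K}
    (hq : IsParameterSystem d q) (i : σ) : q i ∈ idealOfVars σ K := by
  rw [← pow_one (idealOfVars σ K)]
  exact mem_idealOfVars_pow_of_isHomogeneous (hq.isHomogeneous i) (hq.pos i)

section Update

variable [DecidableEq σ]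

theorem update_image_of_notMem (q : σ → MvPolynomial σ K) (p : MvPolynomial σ K) {T : Set σ}
    {i : σ} (hi : i ∉ T) : Function.update q i p '' T = q '' T := by
  refine Set.image_congr fun j hj => Function.update_of_ne ?_ _ _
  rintro rfl
  exact hi hj

theorem span_range_update (q : σ → MvPolynomial σ K) (p : MvPolynomial σ K) (i : σ) :
    Ideal.span (Set.range (Function.update q i p)) =
      Ideal.span (q '' {i}ᶜ) ⊔ Ideal.span {p} := by
  rw [span_range_eq_sup _ i, update_image_of_notMem _ _ (by simp), Function.update_self]

/-- Some power of `q i` is a multiple of `p` modulo the other members of the family. -/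
theorem IsParameterSystem.exists_pow_eq {d : σ → ℕ} {q : σ → MvPolynomial σ K}
    (hq : IsParameterSystem d q) {i : σ} {p : MvPolynomial σ K} {e : ℕ}
    (hp : IsParameterSystem (Function.update d i e) (Function.update q i p)) :
    ∃ k a, e ≤ (k + 1) * d i ∧ a.IsHomogeneous ((k + 1) * d i - e) ∧
      q i ^ (k + 1) - a * p ∈ Ideal.span (q '' {i}ᶜ) := by
  obtain ⟨N, hN⟩ := hp.exists_pow_le
  have hpe : p.IsHomogeneous e := by simpa using hp.isHomogeneous i
  have hdi := hq.pos i
  have hqi : (q i ^ (N + e + 1)).IsHomogeneous ((N + e + 1) * d i) := by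
    rw [mul_comm]; exact (hq.isHomogeneous i).pow _
  -- The exponent N + e + 1 serves twice: the degree is at least N, for membership, and at least e,
  -- so that subtracting e does not truncate.
  have hle : N + e + 1 ≤ (N + e + 1) * d i := Nat.le_mul_of_pos_right _ hdi
  have h1 := hN (mem_idealOfVars_pow_of_isHomogeneous hqi (by omega))
  rw [span_range_update] at h1
  obtain ⟨c, hc⟩ := mem_sup_span_singleton_iff.1 h1
  refine ⟨N + e, homogeneousComponent ((N + e + 1) * d i - e) c, by omega,
    homogeneousComponent_isHomogeneous _ _, ?_⟩
  have h2 := homogeneousComponent_mem_of_mem (hq.isHomogeneous_span_image {i}ᶜ) hc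
    ((N + e + 1) * d i - e + e)
  rw [mul_comm p c, map_sub, homogeneousComponent_add_mul hpe, Nat.sub_add_cancel (by omega),
    homogeneousComponent_eq_self hqi] at h2
  exact h2

theorem IsRegularFamily.update {d : σ → ℕ} {q : σ → MvPolynomial σ K} [Finite σ]
    (hq : IsParameterSystem d q) (hreg : IsRegularFamily q) {i : σ} {p : MvPolynomial σ K}
    (hp : IsRegularMod (Ideal.span (q '' {i}ᶜ)) p) : IsRegularFamily (Function.update q i p) := by
  -- Descent from the full complement of i: the generators indexed by D are dropped one by one with
  -- `IsRegularMod.of_sup`.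
  have main : ∀ D : Set σ, D.Finite → ∀ T : Set σ, T ∪ D = {i}ᶜ →
      IsRegularMod (Ideal.span (q '' T)) p := by
    intro D hD
    induction D, hD using Set.Finite.induction_on with
    | empty => intro T hT; rw [Set.union_empty] at hT; rwa [hT]
    | @insert w D _ _ ih =>
      intro T hT
      have h1 := ih (insert w T) (by rw [← hT, Set.insert_union, Set.union_insert])
      by_cases hw : w ∈ T
      · rwa [Set.insert_eq_of_mem hw] at h1
      · rw [span_image_insert] at h1
        exact IsRegularMod.of_sup (hq.isHomogeneous_span_image T) (hq.mem_idealOfVars w)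
          (hreg T w hw) h1
  have main' : ∀ T : Set σ, i ∉ T → IsRegularMod (Ideal.span (q '' T)) p := fun T hT =>
    main {i}ᶜ (Set.toFinite _) T (Set.union_eq_self_of_subset_left fun j hj => by
      rintro rfl; exact hT hj)
  intro T j hj
  by_cases hji : j = i
  · subst hji
    rw [update_image_of_notMem _ _ hj, Function.update_self]
    exact main' T hj
  · rw [Function.update_of_ne hji]
    by_cases hi : i ∈ T
    · have hT : T = insert i (T \ {i}) := by simp [Set.insert_eq_of_mem hi]
      have hi' : i ∉ T \ {i} := by simp
      have hj' : j ∉ T \ {i} := fun h => hj h.1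
      rw [hT, span_image_insert, update_image_of_notMem _ _ hi', Function.update_self]
      refine (hreg _ j hj').swap ?_
      rw [← span_image_insert]
      exact main' _ (by simp [Ne.symm hji])
    · rw [update_image_of_notMem _ _ hi]
      exact hreg T j hj

/-- Modulo the other members U, some power q_i^(k+1) equals ap, so a and p are regular along with
q_i. The socle passes from U + (q_i) to U + (q_i^(k+1)) = U + (ap), and then down to U + (p) by
dividing by a. -/
theorem IsGorensteinFamily.update [Fintype σ] {d : σ → ℕ} {q : σ → MvPolynomial σ K}
    (hq : IsParameterSystem d q) (hG : IsGorensteinFamily d q) {i : σ} {p : MvPolynomial σ K}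
    {e : ℕ} (hp : IsParameterSystem (Function.update d i e) (Function.update q i p)) :
    IsGorensteinFamily (Function.update d i e) (Function.update q i p) := by
  obtain ⟨k, a, hek, ha, hap⟩ := hq.exists_pow_eq hp
  set U := Ideal.span (q '' {i}ᶜ) with hU
  have hUh := hq.isHomogeneous_span_image {i}ᶜ
  have hqU : IsRegularMod U (q i) := hG.regular _ i (by simp)
  have hmul : ∀ x, (a * p) * x ∈ U → x ∈ U := fun x hx => hqU.pow (k + 1) x <| by
    have := U.add_mem hx (U.mul_mem_right x hap)
    convert this using 1; ring
  have hpU : IsRegularMod U p := fun x hx => hmul x (by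
    rw [mul_assoc]; exact U.mul_mem_left a hx)
  have haU : IsRegularMod U a := fun x hx => hmul x (by
    have := U.mul_mem_left p hx
    convert this using 1; ring)
  have hpe : p.IsHomogeneous e := by simpa using hp.isHomogeneous i
  have hsup : U ⊔ Ideal.span {q i ^ (k + 1)} = U ⊔ Ideal.span {a * p} := by
    apply le_antisymm
    · refine sup_le le_sup_left ((Ideal.span_singleton_le_iff_mem _).2 ?_)
      exact mem_sup_span_singleton_iff.2 ⟨1, by simpa using hap⟩
    · refine sup_le le_sup_left ((Ideal.span_singleton_le_iff_mem _).2 ?_)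
      exact mem_sup_span_singleton_iff.2 ⟨1, by simpa using U.neg_mem hap⟩
  refine ⟨hG.regular.update hq hpU, ?_⟩
  obtain ⟨s, hs, hsoc⟩ := hG.exists_socle
  rw [span_range_eq_sup q i, ← hU] at hsoc
  have hsoc' := hsoc.mul_pow hqU k
  rw [hsup] at hsoc'
  have hW := isHomogeneous_sup_span_singleton hUh (ha.mul hpe)
  have hs' := ((hq.isHomogeneous i).pow k).mul hs
  set s' := q i ^ k * s
  rw [span_range_update, ← hU]
  have hsum : ∑ j, (Function.update d i e j - 1) = (e - 1) + ∑ j ∈ Finset.univ \ {i}, (d j - 1) := by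
    have : (fun j => Function.update d i e j - 1) =
        Function.update (fun j => d j - 1) i (e - 1) := by
      ext j
      by_cases h : j = i
      · subst h; simp
      · simp [h]
    rw [Finset.sum_congr rfl fun j _ => congrFun this j,
      Finset.sum_update_of_mem (Finset.mem_univ i)]
  have hsum' : ∑ j, (d j - 1) = (d i - 1) + ∑ j ∈ Finset.univ \ {i}, (d j - 1) := by
    conv_lhs => rw [← Function.update_eq_self i (fun j => d j - 1)]
    rw [Finset.sum_update_of_mem (Finset.mem_univ i)]
  have hdi := hq.pos i
  have he : 0 < e := by simpa using hp.pos i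
  have hdeg : d i * k + ∑ j, (d j - 1) =
      (∑ j, (Function.update d i e j - 1)) + ((k + 1) * d i - e) := by
    rw [hsum, hsum', add_mul, mul_comm k, one_mul]
    rw [add_mul, mul_comm k, one_mul] at hek
    omega
  rw [hdeg] at hs'
  -- Since a is nonzero modulo U + (ap), the socle generator s' is a multiple of a there.
  have h1 : a * 1 ∉ U ⊔ Ideal.span {a * p} := by
    intro h
    have hsu : (1 : MvPolynomial σ K) ∈ U ⊔ Ideal.span {p} := by
      obtain ⟨c, hc⟩ := mem_sup_span_singleton_iff.1 h
      exact mem_sup_span_singleton_iff.2 ⟨c, haU _ (by convert hc using 1; ring)⟩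
    have hle : U ⊔ Ideal.span {p} ≤ idealOfVars σ K := by
      refine sup_le (Ideal.span_le.2 ?_) ((Ideal.span_singleton_le_iff_mem _).2 ?_)
      · rintro _ ⟨j, -, rfl⟩; exact hq.mem_idealOfVars j
      · simpa using hp.mem_idealOfVars i
    have := homogeneousComponent_eq_zero_of_mem
      (by rw [pow_one]; exact hle hsu : (1 : MvPolynomial σ K) ∈ idealOfVars σ K ^ 1) one_pos
    simp at this
  obtain ⟨y, hy⟩ := mem_sup_span_singleton_iff.1 (hsoc'.2 _ h1)
  have hy' := homogeneousComponent_mem_of_mem hW hy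
    ((∑ j, (Function.update d i e j - 1)) + ((k + 1) * d i - e))
  rw [map_sub, mul_one, mul_comm a y, homogeneousComponent_add_mul ha,
    homogeneousComponent_eq_self hs', mul_comm _ a] at hy'
  exact ⟨_, homogeneousComponent_isHomogeneous _ _, hsoc'.of_mul haU hy'⟩

/-- A linear form avoiding the minimal primes of U other than 𝔪 cuts the zero set of U down to the
origin, by Krull's principal ideal theorem. Finite avoidance lets one form serve both systems. -/
theorem IsParameterSystem.exists_update_linear [Infinite K] [Finite σ] {d d' : σ → ℕ}
    {q q' : σ → MvPolynomial σ K} (hq : IsParameterSystem d q) (hq' : IsParameterSystem d' q')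
    (i : σ) : ∃ z : MvPolynomial σ K,
      IsParameterSystem (Function.update d i 1) (Function.update q i z) ∧
      IsParameterSystem (Function.update d' i 1) (Function.update q' i z) := by
  obtain ⟨z, hz, hzP⟩ := exists_linear_notMem
    ((Ideal.finite_minimalPrimes_of_isNoetherianRing _ (Ideal.span (q '' {i}ᶜ))).union
      (Ideal.finite_minimalPrimes_of_isNoetherianRing _ (Ideal.span (q' '' {i}ᶜ))))
  suffices key : ∀ (d : σ → ℕ) (q : σ → MvPolynomial σ K), IsParameterSystem d q →
      (∀ p ∈ (Ideal.span (q '' {i}ᶜ)).minimalPrimes, ¬ idealOfVars σ K ≤ p → z ∉ p) →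
      IsParameterSystem (Function.update d i 1) (Function.update q i z) from
    ⟨z, key d q hq fun p hp => hzP p (Or.inl hp), key d' q' hq' fun p hp => hzP p (Or.inr hp)⟩
  clear! d d' q q'
  intro d q hq hzp
  refine ⟨fun j => ?_, fun j => ?_, ?_⟩
  · by_cases h : j = i
    · subst h; simp
    · simpa [h] using hq.pos j
  · by_cases h : j = i
    · subst h; simpa using hz
    · simpa [h] using hq.isHomogeneous j
  rw [span_range_update]
  set U := Ideal.span (q '' {i}ᶜ) with hU
  have hUh := hq.isHomogeneous_span_image {i}ᶜ
  refine Ideal.exists_pow_le_of_le_radical_of_fg ?_ (idealOfVars_fg σ K)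
  rw [← Ideal.sInf_minimalPrimes]
  refine le_sInf fun P hP => ?_
  have hPle := le_idealOfVars_of_isHomogeneous
    (isHomogeneous_of_mem_minimalPrimes (isHomogeneous_sup_span_singleton hUh hz) hP) hP.1.1.ne_top
  have := hP.1.1
  obtain ⟨p, hp, hpP⟩ := Ideal.exists_minimalPrimes_le (le_sup_left.trans hP.1.2 : U ≤ P)
  by_cases hmp : idealOfVars σ K ≤ p
  · exact hmp.trans hpP
  have hzp := hzp p hp hmp
  have hzP : z ∈ P := hP.1.2 (Ideal.mem_sup_right (Ideal.mem_span_singleton_self z))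
  by_contra hmP
  have hPlt : P < idealOfVars σ K := lt_of_le_not_ge hPle hmP
  obtain ⟨N, hN⟩ := hq.exists_pow_le
  rw [span_range_eq_sup q i, ← hU] at hN
  have hprime : (idealOfVars σ K).IsPrime := by
    refine Ideal.isPrime_iff.2 ⟨?_, ?_⟩
    · intro h
      have h1 : (1 : MvPolynomial σ K) ∈ idealOfVars σ K ^ 1 := by rw [pow_one, h]; trivial
      simpa using homogeneousComponent_eq_zero_of_mem h1 one_pos
    · intro x y hxy
      have h0 : ∀ x : MvPolynomial σ K, x ∈ idealOfVars σ K ↔ constantCoeff x = 0 := by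
        intro x
        rw [← pow_one (idealOfVars σ K), mem_pow_idealOfVars_iff', constantCoeff_eq]
        refine ⟨fun h => h 0 (by simp), fun h m hm => ?_⟩
        obtain rfl : m = 0 := by rw [← Finsupp.degree_eq_zero_iff]; omega
        exact h
      simpa [h0] using hxy
  -- So 𝔪/p has height at most 1, whereas the chain p < P < 𝔪 gives height at least 2.
  have hmin : idealOfVars σ K ∈ (p ⊔ Ideal.span {q i}).minimalPrimes := by
    refine ⟨⟨hprime, sup_le (hpP.trans hPle) ?_⟩, fun J hJ _ => ?_⟩
    · exact (Ideal.span_singleton_le_iff_mem _).2 (hq.mem_idealOfVars i)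
    · exact hJ.1.le_of_pow_le (hN.trans ((sup_le_sup_right hp.1.2 _).trans hJ.2))
  have hht := Ideal.map_height_le_one_of_mem_minimalPrimes hmin
  have hpprime := hp.1.1
  have hker : RingHom.ker (Ideal.Quotient.mk p) ≤ P := by rwa [Ideal.mk_ker]
  have hP' : (P.map (Ideal.Quotient.mk p)).IsPrime :=
    Ideal.map_isPrime_of_surjective Ideal.Quotient.mk_surjective hker
  have hm' : ((idealOfVars σ K).map (Ideal.Quotient.mk p)).IsPrime :=
    Ideal.map_isPrime_of_surjective Ideal.Quotient.mk_surjective (hker.trans hPle)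
  have hlt1 : (⊥ : Ideal (MvPolynomial σ K ⧸ p)) < P.map (Ideal.Quotient.mk p) := by
    rw [bot_lt_iff_ne_bot]
    intro h
    have h1 : Ideal.Quotient.mk p z ∈ P.map (Ideal.Quotient.mk p) := Ideal.mem_map_of_mem _ hzP
    rw [h, Ideal.mem_bot, Ideal.Quotient.eq_zero_iff_mem] at h1
    exact hzp h1
  have hlt2 : P.map (Ideal.Quotient.mk p) < (idealOfVars σ K).map (Ideal.Quotient.mk p) := by
    refine lt_of_le_not_ge (Ideal.map_mono hPle) fun h => hmP ?_
    have := Ideal.comap_mono (f := Ideal.Quotient.mk p) h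
    rwa [Ideal.comap_map_of_surjective _ Ideal.Quotient.mk_surjective,
      Ideal.comap_map_of_surjective _ Ideal.Quotient.mk_surjective, ← RingHom.ker_eq_comap_bot,
      sup_eq_left.2 hker, sup_eq_left.2 (hker.trans hPle)] at this
  have e1 := Ideal.height_add_one_le_of_lt_of_isPrime hlt1
  have e2 := Ideal.height_add_one_le_of_lt_of_isPrime hlt2
  have : (2 : ℕ∞) ≤ 1 := calc
    (2 : ℕ∞) = 1 + 1 := by norm_num
    _ ≤ (⊥ : Ideal (MvPolynomial σ K ⧸ p)).height + 1 + 1 := by gcongr; simp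
    _ ≤ _ := (add_le_add_left e1 1).trans (e2.trans hht)
  exact absurd this (by norm_num)

end Update

theorem isParameterSystem_X : IsParameterSystem (fun _ => 1) (X : σ → MvPolynomial σ K) :=
  ⟨fun _ => one_pos, fun i => isHomogeneous_X K i, 1, by rw [pow_one]⟩

theorem isGorensteinFamily_X [Fintype σ] :
    IsGorensteinFamily (fun _ => 1) (X : σ → MvPolynomial σ K) := by
  refine ⟨fun T i hi x hx => ?_, 1, by simpa using isHomogeneous_one σ K, ?_, fun x hx => ?_⟩
  · rw [mem_ideal_span_X_image] at hx ⊢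
    intro m hm
    obtain ⟨j, hj, hmj⟩ := hx (m + Finsupp.single i 1) (by
      rw [mem_support_iff, mul_comm, coeff_mul_X]
      exact mem_support_iff.1 hm)
    refine ⟨j, hj, ?_⟩
    have : i ≠ j := by rintro rfl; exact hi hj
    simpa [Finsupp.single_apply, this] using hmj
  · intro h
    have h1 : (1 : MvPolynomial σ K) ∈ idealOfVars σ K ^ 1 := by rwa [pow_one]
    simpa using homogeneousComponent_eq_zero_of_mem h1 one_pos
  · have h0 : coeff 0 x ≠ 0 := by
      intro h0
      apply hx
      change x ∈ idealOfVars σ K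
      rw [← pow_one (idealOfVars σ K), mem_pow_idealOfVars_iff']
      intro m hm
      obtain rfl : m = 0 := by rw [← Finsupp.degree_eq_zero_iff]; omega
      exact h0
    refine mem_sup_span_singleton_iff.2 ⟨C (coeff 0 x)⁻¹, ?_⟩
    change _ ∈ idealOfVars σ K
    rw [← pow_one (idealOfVars σ K), mem_pow_idealOfVars_iff']
    intro m hm
    obtain rfl : m = 0 := by rw [← Finsupp.degree_eq_zero_iff]; omega
    rw [mul_comm, coeff_sub, coeff_C_mul, inv_mul_cancel₀ h0]
    simp

theorem IsParameterSystem.isGorensteinFamily [Infinite K] [Fintype σ] {d : σ → ℕ}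
    {q : σ → MvPolynomial σ K} (hq : IsParameterSystem d q) : IsGorensteinFamily d q := by
  classical
  -- The same linear forms replace members of q and of X in parallel. Once all are replaced the two
  -- families coincide, and the stored implication leads back to q.
  have key : ∀ s : Finset σ, ∃ z : σ → MvPolynomial σ K,
      IsParameterSystem (s.piecewise (fun _ => 1) d) (s.piecewise z q) ∧
      IsParameterSystem (s.piecewise (fun _ => 1) fun _ => 1) (s.piecewise z X) ∧
      IsGorensteinFamily (s.piecewise (fun _ => 1) fun _ => 1) (s.piecewise z X) ∧
      (IsGorensteinFamily (s.piecewise (fun _ => 1) d) (s.piecewise z q) →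
        IsGorensteinFamily d q) := by
    intro s
    induction s using Finset.induction_on with
    | empty =>
      refine ⟨X, ?_⟩
      simpa using ⟨hq, isParameterSystem_X, isGorensteinFamily_X⟩
    | @insert i s hi ih =>
      obtain ⟨z, h1, h2, h3, h4⟩ := ih
      obtain ⟨y, hy1, hy2⟩ := h1.exists_update_linear h2 i
      have e : ∀ q : σ → MvPolynomial σ K, (insert i s).piecewise (Function.update z i y) q =
          Function.update (s.piecewise z q) i y := by
        intro q
        rw [Finset.piecewise_insert, Function.update_self]
        ext1 j
        by_cases h : j = i
        · subst h; simp
        · by_cases hj : j ∈ s <;> simp [h, hj]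
      refine ⟨Function.update z i y, ?_⟩
      rw [e, e, Finset.piecewise_insert, Finset.piecewise_insert]
      refine ⟨hy1, hy2, h3.update h2 hy2, fun h => h4 ?_⟩
      have := h.update hy1 (i := i) (e := s.piecewise (fun _ => 1) d i) (p := s.piecewise z q i)
        (by simpa using h1)
      simpa using this
  obtain ⟨z, -, -, h3, h4⟩ := key Finset.univ
  apply h4
  simpa using h3

end ParameterSystems

/-! ### Graded duality modulo a parameter system. -/

section Duality

variable {σ K : Type*} [Field K] [Fintype σ]

theorem IsGorensteinFamily.exists_mul_sub_mem {d : σ → ℕ} {q : σ → MvPolynomial σ K}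
    {s : MvPolynomial σ K} (hq : IsParameterSystem d q) (hs : s.IsHomogeneous (∑ i, (d i - 1)))
    (hsoc : IsSocleGenerator (Ideal.span (Set.range q)) s) {x : MvPolynomial σ K} {a : ℕ}
    (hx : x.IsHomogeneous a) (hxQ : x ∉ Ideal.span (Set.range q)) :
    ∃ i, i + a = ∑ j, (d j - 1) ∧ ∃ y : MvPolynomial σ K, y.IsHomogeneous i ∧
      s - y * x ∈ Ideal.span (Set.range q) := by
  have hQ : (Ideal.span (Set.range q)).IsHomogeneous (homogeneousSubmodule σ K) := by
    simpa using hq.isHomogeneous_span_image Set.univ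
  obtain ⟨y, hy⟩ := mem_sup_span_singleton_iff.1 (hsoc.2 x hxQ)
  rw [mul_comm] at hy
  have h1 := homogeneousComponent_mem_of_mem hQ hy (∑ j, (d j - 1))
  rw [map_sub, homogeneousComponent_eq_self hs] at h1
  rcases lt_or_ge (∑ j, (d j - 1)) a with h | h
  · rw [homogeneousComponent_mul_of_lt hx _ h, sub_zero] at h1
    exact absurd h1 hsoc.1
  · obtain ⟨i, hi⟩ := Nat.exists_eq_add_of_le' h
    rw [hi, homogeneousComponent_add_mul hx] at h1
    exact ⟨i, hi.symm, _, homogeneousComponent_isHomogeneous _ _, h1⟩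

/-- Graded duality in a complete intersection of dimension zero: the principal ideal generated by
`p` is its own double annihilator. -/
theorem IsParameterSystem.mem_sup_of_forall_mul_mem [Infinite K] {d : σ → ℕ}
    {q : σ → MvPolynomial σ K} (hq : IsParameterSystem d q) {p x : MvPolynomial σ K} {e a : ℕ}
    (hp : p.IsHomogeneous e) (hx : x.IsHomogeneous a)
    (h : ∀ (i : ℕ) (u : MvPolynomial σ K), i + a = ∑ j, (d j - 1) → u.IsHomogeneous i →
      p * u ∈ Ideal.span (Set.range q) → x * u ∈ Ideal.span (Set.range q)) :
    x ∈ Ideal.span (Set.range q) ⊔ Ideal.span {p} := by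
  obtain ⟨s, hs, hsoc⟩ := hq.isGorensteinFamily.exists_socle
  set Q := Ideal.span (Set.range q)
  by_contra hxW
  obtain ⟨i, hia, -⟩ := IsGorensteinFamily.exists_mul_sub_mem hq hs hsoc hx
    fun h' => hxW (Ideal.mem_sup_left h')
  -- The pairing (u, x) ↦ τ(ux) is nondegenerate modulo Q, so a functional φ killing W but not x has
  -- the form τ(u·). Then pu ∈ Q, hence xu ∈ Q and φ(x) = 0, a contradiction.
  obtain ⟨τ, hτs, hτQ⟩ := Submodule.exists_le_ker_of_notMem
    (show s ∉ Q.restrictScalars K from hsoc.1)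
  have hτQ' : ∀ z ∈ Q, τ z = 0 := fun z hz => hτQ hz
  have hτ : ∀ z y, s - y * z ∈ Q → τ (y * z) ≠ 0 := by
    intro z y hz
    have := hτQ' _ hz
    rw [map_sub, sub_eq_zero] at this
    rwa [← this]
  let E := homogeneousSubmodule σ K a
  have : Module.Finite K E := Module.Finite.iff_fg.2 (homogeneousSubmodule_fg σ K a)
  obtain ⟨F, hF⟩ : ∃ F : homogeneousSubmodule σ K i →ₗ[K] Module.Dual K E,
      ∀ u x, F u x = τ (u.1 * x.1) :=
    ⟨((LinearMap.mul K _).compr₂ τ).domRestrict₁₂ _ _, fun _ _ => rfl⟩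
  let W : Submodule K E := ((Q ⊔ Ideal.span {p}).restrictScalars K).comap E.subtype
  obtain ⟨φ, hφx, hφW⟩ := Submodule.exists_le_ker_of_notMem (show (⟨x, hx⟩ : E) ∉ W from hxW)
  have hco : (LinearMap.range F).dualCoannihilator ≤ W := by
    intro y hy
    rw [Submodule.mem_dualCoannihilator] at hy
    refine Ideal.mem_sup_left ?_
    by_contra hyQ
    obtain ⟨i', hi', u, hu, hsu⟩ := IsGorensteinFamily.exists_mul_sub_mem hq hs hsoc y.2 hyQ
    obtain rfl : i' = i := by omega
    exact hτ _ _ hsu ((hF ⟨u, hu⟩ y).symm.trans (hy _ ⟨_, rfl⟩))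
  have hφ : φ ∈ LinearMap.range F := by
    rw [← Subspace.dualCoannihilator_dualAnnihilator_eq (W := LinearMap.range F)]
    exact Submodule.dualAnnihilator_anti hco
      ((Submodule.mem_dualAnnihilator _).2 fun w hw => hφW hw)
  obtain ⟨u, rfl⟩ := hφ
  have hpu : p * u ∈ Q := by
    by_contra hpu
    obtain ⟨k, hk, y, hy, hsy⟩ :=
      IsGorensteinFamily.exists_mul_sub_mem hq hs hsoc (hp.mul u.2) hpu
    refine hτ _ _ hsy ?_
    have hyp : (y * p).IsHomogeneous a := by
      convert hy.mul hp using 1; omega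
    have h1 : (⟨y * p, hyp⟩ : E) ∈ W :=
      Ideal.mem_sup_right (Ideal.mul_mem_left _ _ (Ideal.mem_span_singleton_self p))
    have h2 : F u ⟨y * p, hyp⟩ = 0 := hφW h1
    rw [hF] at h2
    rw [← h2]
    congr 1; ring
  apply hφx
  rw [hF, mul_comm]
  exact hτQ' _ (h i u hia u.2 hpu)

end Duality

/-! ### Nullstellensatz and choice of a parameter system. -/

section Zeros

variable {σ ι : Type*}

theorem exists_pow_idealOfVars_le {K : Type*} [Field K] [IsAlgClosed K] [Finite σ]
    {q : ι → MvPolynomial σ K} (h : ∀ v : σ → K, (∀ i, eval v (q i) = 0) → v = 0) :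
    ∃ N, idealOfVars σ K ^ N ≤ Ideal.span (Set.range q) := by
  refine Ideal.exists_pow_le_of_le_radical_of_fg ?_ (idealOfVars_fg σ K)
  rw [← vanishingIdeal_zeroLocus_eq_radical (K := K), idealOfVars, Ideal.span_le]
  rintro _ ⟨i, rfl⟩
  rw [SetLike.mem_coe, mem_vanishingIdeal_iff]
  intro v hv
  rw [h v fun j => by simpa [aeval_eq_eval] using hv _ (Ideal.subset_span ⟨j, rfl⟩)]
  simp

theorem eval_smul_of_isHomogeneous {K : Type*} [CommSemiring K] [Fintype σ] {q : MvPolynomial σ K}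
    {e : ℕ} (hq : q.IsHomogeneous e) (c : K) (v : σ → K) :
    eval (c • v) q = c ^ e * eval v q := by
  rw [eval_eq', eval_eq', Finset.mul_sum]
  refine Finset.sum_congr rfl fun m hm => ?_
  have hdeg : ∑ i, m i = e := by
    rw [← Finsupp.degree_eq_sum, Finsupp.degree_eq_weight_one]
    exact hq (mem_support_iff.1 hm)
  simp only [Pi.smul_apply, smul_eq_mul, mul_pow, Finset.prod_mul_distrib,
    Finset.prod_pow_eq_pow_sum, hdeg]
  ring

/-- The n + 1 forms in n variables are algebraically dependent, so the map they define misses a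
point p of K^(n+1). Projecting from p creates no new zeros: if F(v) = tp with t ≠ 0, rescaling v by
an e-th root of t⁻¹ would reach p. -/
theorem exists_isParameterSystem_sub {K : Type*} [Field K] [IsAlgClosed K] {n e : ℕ} (he : 0 < e)
    {F : Fin (n + 1) → MvPolynomial (Fin n) K} (hF : ∀ i, (F i).IsHomogeneous e)
    (h : ∀ v : Fin n → K, (∀ i, eval v (F i) = 0) → v = 0) :
    ∃ (i₀ : Fin (n + 1)) (c : Fin n → K), IsParameterSystem (fun _ => e)
      fun j => F (i₀.succAbove j) - C (c j) * F i₀ := by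
  have hdep : ¬ AlgebraicIndependent K F := by
    intro hind
    have := hind.lift_cardinalMk_le_trdeg
    rw [trdeg_of_isDomain] at this
    simp only [Cardinal.mk_fin, Cardinal.lift_natCast, Nat.cast_le] at this
    omega
  obtain ⟨P, hP, hP0⟩ : ∃ P, aeval F P = 0 ∧ P ≠ 0 := by
    rw [algebraicIndependent_iff] at hdep
    push Not at hdep
    exact hdep
  obtain ⟨p, hp⟩ : ∃ p, eval p P ≠ 0 := by
    by_contra! hcon
    exact hP0 (MvPolynomial.funext fun x => by rw [hcon, map_zero])
  have himg : ∀ v : Fin n → K, (fun i => eval v (F i)) ≠ p := by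
    rintro v rfl
    apply hp
    have := congrArg (eval v) hP
    rw [map_zero, aeval_def, ← coe_eval₂Hom, ← RingHom.comp_apply, comp_eval₂Hom] at this
    convert this using 2
    rw [eval]
    congr 1
    ext a
    simp [algebraMap_eq]
  obtain ⟨i₀, hi₀⟩ : ∃ i, p i ≠ 0 := by
    by_contra! hcon
    refine himg 0 (_root_.funext fun i => ?_)
    have h0 := eval_smul_of_isHomogeneous (hF i) 0 (0 : Fin n → K)
    rw [smul_zero, zero_pow he.ne', zero_mul] at h0
    rw [h0, hcon]
  refine ⟨i₀, fun j => p (i₀.succAbove j) / p i₀, fun _ => he, fun j => ?_,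
    exists_pow_idealOfVars_le fun v hv => h v ?_⟩
  · refine (hF _).sub ?_
    simpa using (isHomogeneous_C (Fin n) _).mul (hF i₀)
  · have hv' : ∀ i, eval v (F i) = (eval v (F i₀) / p i₀) * p i := by
      intro i
      induction i using Fin.succAboveCases i₀ with
      | x => field_simp
      | p j =>
        have := hv j
        simp only [map_sub, map_mul, eval_C, sub_eq_zero] at this
        rw [this]; ring
    set t := eval v (F i₀) / p i₀
    by_cases ht : t = 0
    · intro i; rw [hv', ht, zero_mul]
    · obtain ⟨z, hz⟩ := IsAlgClosed.exists_pow_nat_eq t⁻¹ he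
      refine absurd (_root_.funext fun i => ?_) (himg (z • v))
      rw [eval_smul_of_isHomogeneous (hF i), hz, hv', inv_mul_cancel_left₀ ht]

end Zeros

/-! ### Homogeneous coefficients in ideals generated in one degree. -/

section Span

variable {σ K ι : Type*} [Field K] [Fintype ι]

theorem eq_zero_of_mem_span_of_lt {q : ι → MvPolynomial σ K} {e k : ℕ}
    (hq : ∀ i, (q i).IsHomogeneous e) {x : MvPolynomial σ K} (hx : x.IsHomogeneous k)
    (h : x ∈ Ideal.span (Set.range q)) (hk : k < e) : x = 0 := by
  obtain ⟨c, rfl⟩ := Ideal.mem_span_range_iff_exists_fun.1 h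
  rw [← homogeneousComponent_eq_self hx, map_sum]
  exact Finset.sum_eq_zero fun i _ => homogeneousComponent_mul_of_lt (hq i) _ hk

theorem exists_isHomogeneous_of_mem_span {q : ι → MvPolynomial σ K} {e k : ℕ}
    (hq : ∀ i, (q i).IsHomogeneous e) {x : MvPolynomial σ K} (hx : x.IsHomogeneous (k + e))
    (h : x ∈ Ideal.span (Set.range q)) :
    ∃ a : ι → MvPolynomial σ K, (∀ i, (a i).IsHomogeneous k) ∧ ∑ i, a i * q i = x := by
  obtain ⟨c, rfl⟩ := Ideal.mem_span_range_iff_exists_fun.1 h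
  refine ⟨fun i => homogeneousComponent k (c i), fun i => homogeneousComponent_isHomogeneous _ _, ?_⟩
  conv_rhs => rw [← homogeneousComponent_eq_self hx, map_sum]
  exact Finset.sum_congr rfl fun i _ => (homogeneousComponent_add_mul (hq i) _ _).symm

end Span

/-! ### Restriction to the hyperplane, its kernel and its lifts. -/

section Restriction

variable {m n : ℕ} {ℓ : Module.Dual ℂ (Fin m → ℂ)}

/-- The splitting ℂ^m = ℂv ⊕ ker ℓ with ℓ(v) = 1; the φ_j extend the dual basis of b by zero on v.
It replaces a change of coordinates taking ℓ to a variable. -/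
theorem exists_dual_decomposition (hℓ : ℓ ≠ 0) (b : Module.Basis (Fin n) ℂ (LinearMap.ker ℓ)) :
    ∃ (v : Fin m → ℂ) (φ : Fin n → Module.Dual ℂ (Fin m → ℂ)),
      (∀ j k, φ j (b k : Fin m → ℂ) = if k = j then 1 else 0) ∧
      ∀ w, w = ℓ w • v + ∑ j, φ j w • (b j : Fin m → ℂ) := by
  obtain ⟨u, hu⟩ : ∃ u, ℓ u ≠ 0 := by
    by_contra! h
    exact hℓ (LinearMap.ext h)
  let v := (ℓ u)⁻¹ • u
  have hv : ℓ v = 1 := by simp [v, hu]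
  let P : (Fin m → ℂ) →ₗ[ℂ] LinearMap.ker ℓ :=
    (LinearMap.id - ℓ.smulRight v).codRestrict _ (fun w => by simp [hv])
  have hP : ∀ w, (P w : Fin m → ℂ) = w - ℓ w • v := fun w => rfl
  refine ⟨v, fun j => b.coord j ∘ₗ P, fun j k => ?_, fun w => ?_⟩
  · have : P (b k) = b k := Subtype.ext (by rw [hP, LinearMap.mem_ker.1 (b k).2]; simp)
    simp [this, Finsupp.single_apply]
  · have h1 := congrArg (Subtype.val) (b.sum_repr (P w))
    rw [hP] at h1
    simp only [AddSubmonoidClass.coe_finsetSum, Submodule.coe_smul_of_tower] at h1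
    simp only [LinearMap.coe_comp, Function.comp_apply, Module.Basis.coord_apply]
    rw [h1]
    abel

/-- Restriction of polynomials to the hyperplane `ℓ = 0`, in the coordinates given by `b`. -/
noncomputable def restrict (b : Module.Basis (Fin n) ℂ (LinearMap.ker ℓ)) :
    MvPolynomial (Fin m) ℂ →ₐ[ℂ] MvPolynomial (Fin n) ℂ :=
  aeval fun i => ∑ j, C ((b j : Fin m → ℂ) i) * X j

variable (b : Module.Basis (Fin n) ℂ (LinearMap.ker ℓ))

theorem isHomogeneous_restrict {q : MvPolynomial (Fin m) ℂ} {k : ℕ} (hq : q.IsHomogeneous k) :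
    (restrict b q).IsHomogeneous k := by
  rw [← one_mul k]
  refine hq.aeval _ fun i => IsHomogeneous.sum _ _ _ fun j _ => ?_
  simpa using (isHomogeneous_C (Fin n) _).mul (isHomogeneous_X ℂ j)

theorem eval_restrict (y : Fin n → ℂ) (q : MvPolynomial (Fin m) ℂ) :
    eval y (restrict b q) = eval (∑ j, y j • (b j : Fin m → ℂ)) q := by
  induction q using MvPolynomial.induction_on with
  | C a => simp [restrict]
  | add p q hp hq => simp [hp, hq]
  | mul_X p i hp =>
    rw [map_mul, map_mul, map_mul, hp]
    simp [restrict, mul_comm]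

theorem restrict_linearForm (φ : Module.Dual ℂ (Fin m → ℂ)) :
    restrict b (linearForm φ) = ∑ j, C (φ (b j)) * X j := by
  refine MvPolynomial.funext fun y => ?_
  rw [eval_restrict, eval_linearForm]
  simp [mul_comm]

theorem restrict_linearForm_self : restrict b (linearForm ℓ) = 0 := by
  rw [restrict_linearForm]
  exact Finset.sum_eq_zero fun j _ => by rw [LinearMap.mem_ker.1 (b j).2, C_0, zero_mul]

variable {b}

theorem exists_restrict_eq (hℓ : ℓ ≠ 0) {k : ℕ} {u : MvPolynomial (Fin n) ℂ}
    (hu : u.IsHomogeneous k) : ∃ U : MvPolynomial (Fin m) ℂ, U.IsHomogeneous k ∧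
      restrict b U = u := by
  obtain ⟨v, φ, hφ, -⟩ := exists_dual_decomposition hℓ b
  refine ⟨aeval (fun j => linearForm (φ j)) u, ?_, ?_⟩
  · rw [← one_mul k]
    exact hu.aeval _ fun j => linearForm_isHomogeneous _
  · have : (restrict b).comp (aeval fun j => linearForm (φ j)) = AlgHom.id ℂ _ := by
      ext1 j
      simp [restrict_linearForm, hφ]
    exact DFunLike.congr_fun this u

/-- Restricting and then substituting the φ_j for the y_j changes x_i by v_i ℓ only, so it is the
identity modulo ℓ. -/
theorem mem_span_of_restrict_eq_zero (hℓ : ℓ ≠ 0) {x : MvPolynomial (Fin m) ℂ}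
    (hx : restrict b x = 0) : x ∈ Ideal.span {linearForm ℓ} := by
  obtain ⟨v, φ, -, hv⟩ := exists_dual_decomposition hℓ b
  let ψ : MvPolynomial (Fin n) ℂ →ₐ[ℂ] MvPolynomial (Fin m) ℂ :=
    aeval (fun j => linearForm (φ j))
  let mk := Ideal.Quotient.mkₐ ℂ (Ideal.span {linearForm ℓ})
  have : mk.comp (ψ.comp (restrict b)) = mk := by
    ext1 i
    refine (Ideal.Quotient.eq.2 (Ideal.mem_span_singleton'.2 ⟨-C (v i), ?_⟩))
    refine MvPolynomial.funext fun w => ?_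
    have h1 := congrFun (hv w) i
    simp only [Pi.add_apply, Pi.smul_apply, Finset.sum_apply, smul_eq_mul] at h1
    simp only [ψ, restrict, AlgHom.comp_apply, AlgHom.coe_toRingHom, aeval_X, map_mul, map_neg,
      eval_C, eval_linearForm, map_sub, eval_X, map_sum, algHom_C, algebraMap_eq]
    rw [h1]
    simp only [mul_comm (φ _ w)]
    ring
  have h1 := DFunLike.congr_fun this x
  rw [AlgHom.comp_apply, AlgHom.comp_apply, hx, map_zero, map_zero] at h1
  exact Ideal.Quotient.eq_zero_iff_mem.1 h1.symm

theorem mem_sup_of_restrict_mem (hℓ : ℓ ≠ 0) {Q : Ideal (MvPolynomial (Fin m) ℂ)}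
    {x : MvPolynomial (Fin m) ℂ} (hx : restrict b x ∈ Q.map (restrict b)) :
    x ∈ Q ⊔ Ideal.span {linearForm ℓ} := by
  have hsurj : Function.Surjective (restrict b) := by
    intro u
    obtain ⟨U, hU⟩ : ∃ U : MvPolynomial (Fin m) ℂ, restrict b U = u := by
      rw [← sum_homogeneousComponent u]
      choose U _ hU using fun k =>
        exists_restrict_eq (b := b) hℓ (homogeneousComponent_isHomogeneous k u)
      exact ⟨∑ k ∈ Finset.range (u.totalDegree + 1), U k, by simp [hU]⟩
    exact ⟨U, hU⟩
  obtain ⟨z, hz, hzx⟩ := (Ideal.mem_map_iff_of_surjective _ hsurj).1 hx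
  refine Submodule.mem_sup.2 ⟨z, hz, x - z, ?_, by ring⟩
  exact mem_span_of_restrict_eq_zero hℓ (by rw [map_sub, hzx, sub_self])

theorem linearForm_ne_zero (hℓ : ℓ ≠ 0) : linearForm ℓ ≠ 0 := by
  intro h
  refine hℓ (LinearMap.ext fun v => ?_)
  rw [← eval_linearForm, h, map_zero, LinearMap.zero_apply]

end Restriction

/-! ### Directional derivatives and the chain rule on the hyperplane. -/

section DirectionalDerivative

variable {m n : ℕ} {ℓ : Module.Dual ℂ (Fin m → ℂ)}

/-- The derivative of `f` in the direction `w`, as a linear function of `w`. -/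
noncomputable def dirDeriv (f : MvPolynomial (Fin m) ℂ) :
    (Fin m → ℂ) →ₗ[ℂ] MvPolynomial (Fin m) ℂ :=
  Fintype.linearCombination ℂ fun i => pderiv i f

theorem dirDeriv_apply (f : MvPolynomial (Fin m) ℂ) (w : Fin m → ℂ) :
    dirDeriv f w = ∑ i, w i • pderiv i f :=
  Fintype.linearCombination_apply _ _ _

theorem isHomogeneous_dirDeriv {f : MvPolynomial (Fin m) ℂ} {d : ℕ} (hf : f.IsHomogeneous d)
    (w : Fin m → ℂ) : (dirDeriv f w).IsHomogeneous (d - 1) := by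
  rw [dirDeriv_apply]
  exact (homogeneousSubmodule (Fin m) ℂ (d - 1)).sum_mem fun i _ =>
    Submodule.smul_mem _ _ hf.pderiv

theorem pderiv_restrict (b : Module.Basis (Fin n) ℂ (LinearMap.ker ℓ))
    (f : MvPolynomial (Fin m) ℂ) (j : Fin n) :
    pderiv j (restrict b f) = restrict b (dirDeriv f (b j)) := by
  simp only [dirDeriv_apply]
  induction f using MvPolynomial.induction_on with
  | C a => simp [restrict]
  | add p q hp hq => simp [hp, hq, Finset.sum_add_distrib]
  | mul_X p i hp =>
    have h1 : pderiv j (restrict b (X i)) = C ((b j : Fin m → ℂ) i) := by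
      simp [restrict, pderiv_X, Pi.single_apply]
    have h2 : ∑ k, (b j : Fin m → ℂ) k • pderiv k (p * X i) =
        (∑ k, (b j : Fin m → ℂ) k • pderiv k p) * X i + p * C ((b j : Fin m → ℂ) i) := by
      simp [Derivation.leibniz, pderiv_X, Pi.single_apply, Finset.sum_add_distrib, smul_eq_C_mul,
        Finset.mul_sum, mul_comm, mul_left_comm, add_comm]
    rw [h2, map_mul, Derivation.leibniz, h1, hp, map_add, map_mul, map_mul]
    simp only [smul_eq_mul, restrict, algHom_C, algebraMap_eq]
    ring

theorem jacobianIdeal_eq_span {f : MvPolynomial (Fin m) ℂ}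
    {b : Module.Basis (Fin n) ℂ (LinearMap.ker ℓ)} {v : Fin m → ℂ}
    {φ : Fin n → Module.Dual ℂ (Fin m → ℂ)}
    (h : ∀ w, w = ℓ w • v + ∑ j, φ j w • (b j : Fin m → ℂ)) :
    jacobianIdeal f = Ideal.span (Set.range
      (Fin.cons (dirDeriv f v) fun j => dirDeriv f (b j) : Fin (n + 1) → _)) := by
  apply le_antisymm
  · refine Ideal.span_le.2 ?_
    rintro _ ⟨i, rfl⟩
    have h1 : pderiv i f = dirDeriv f (Pi.single i 1) := by
      simp [dirDeriv_apply, Pi.single_apply, ite_smul]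
    have h2 := congrArg (dirDeriv f) (h (Pi.single i 1))
    rw [← h1, map_add, map_sum] at h2
    simp only [map_smul, smul_eq_C_mul] at h2
    change pderiv i f ∈ _
    rw [h2]
    refine Ideal.add_mem _ (Ideal.mul_mem_left _ _ (Ideal.subset_span ⟨0, by simp⟩))
      (Ideal.sum_mem _ fun j _ => Ideal.mul_mem_left _ _ (Ideal.subset_span ⟨j.succ, by simp⟩))
  · have hD : ∀ w, dirDeriv f w ∈ jacobianIdeal f := by
      intro w
      rw [dirDeriv_apply]
      refine Ideal.sum_mem _ fun i _ => ?_
      rw [smul_eq_C_mul]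
      exact Ideal.mul_mem_left _ _ (Ideal.subset_span ⟨i, rfl⟩)
    refine Ideal.span_le.2 ?_
    rintro _ ⟨j, rfl⟩
    induction j using Fin.cases with
    | zero => simpa using hD v
    | succ j => simpa using hD _

end DirectionalDerivative

/-! ### The partials of f have no common zero on H. -/

section Singularities

variable {m n : ℕ} {ℓ : Module.Dual ℂ (Fin m → ℂ)} {f : MvPolynomial (Fin m) ℂ} {d : ℕ}

/-- Euler's formula makes f(w) = 0 a consequence of the vanishing of the partials. -/
theorem eq_zero_of_hyperplane_inter_singularLocus (hd : 0 < d) (hf : f.IsHomogeneous d)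
    (hH : hyperplane ℓ ∩ singularLocus f = ∅) {w : Fin m → ℂ} (hw : ℓ w = 0)
    (h : ∀ i, eval w (pderiv i f) = 0) : w = 0 := by
  by_contra hw0
  let p := Projectivization.mk ℂ w hw0
  obtain ⟨a, ha⟩ := Projectivization.exists_smul_eq_mk_rep ℂ w hw0
  have hrep : p.rep = (a : ℂ) • w := ha.symm
  have hfw : eval w f = 0 := by
    have h1 := congrArg (eval w) hf.sum_X_mul_pderiv
    simp only [map_sum, map_mul, h, mul_zero, Finset.sum_const_zero, map_nsmul] at h1
    have h2 := h1.symm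
    rw [nsmul_eq_mul, mul_eq_zero] at h2
    exact h2.resolve_left (by exact_mod_cast hd.ne')
  have hmem : p ∈ hyperplane ℓ ∩ singularLocus f := by
    refine ⟨?_, ?_, fun i => ?_⟩
    · change ℓ p.rep = 0
      rw [hrep, map_smul, hw, smul_zero]
    · rw [hrep, eval_smul_of_isHomogeneous hf, hfw, mul_zero]
    · rw [hrep, eval_smul_of_isHomogeneous hf.pderiv, h, mul_zero]
  rw [hH] at hmem
  exact hmem

theorem eq_zero_of_eval_restrict_pderiv (hd : 0 < d) (hf : f.IsHomogeneous d)
    (hH : hyperplane ℓ ∩ singularLocus f = ∅) (b : Module.Basis (Fin n) ℂ (LinearMap.ker ℓ))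
    {y : Fin n → ℂ} (h : ∀ i, eval y (restrict b (pderiv i f)) = 0) : y = 0 := by
  simp only [eval_restrict] at h
  have h1 : ∑ j, y j • (b j : Fin m → ℂ) = ((∑ j, y j • b j : LinearMap.ker ℓ) : Fin m → ℂ) := by
    simp
  have h2 := eq_zero_of_hyperplane_inter_singularLocus hd hf hH
    (by rw [h1]; exact LinearMap.mem_ker.1 (Subtype.prop _)) h
  rw [h1, Submodule.coe_eq_zero] at h2
  exact _root_.funext (Fintype.linearIndependent_iff.1 b.linearIndependent y h2)

end Singularities

/-! ### Saturation computed by powers of one linear form. -/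

section Saturation

/-- A high power of 𝔪 lies in (J + (l))^(1+M), which is contained in J + (l^M). -/
theorem mem_saturation_iff_exists_pow_mul_mem {m N : ℕ} {J : Ideal (MvPolynomial (Fin m) ℂ)}
    {l : MvPolynomial (Fin m) ℂ} (hl : l ∈ irrelevantIdeal m)
    (hJ : irrelevantIdeal m ^ N ≤ J ⊔ Ideal.span {l}) {x : MvPolynomial (Fin m) ℂ} :
    x ∈ saturation J ↔ ∃ M, l ^ M * x ∈ J := by
  rw [mem_saturation_iff]
  constructor
  · rintro ⟨M, hM⟩
    exact ⟨M, by rw [mul_comm]; exact hM _ (Ideal.pow_mem_pow hl M)⟩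
  · rintro ⟨M, hM⟩
    refine ⟨N * (1 + M), fun p hp => ?_⟩
    rw [pow_mul] at hp
    have h1 := Ideal.sup_pow_add_le_pow_sup_pow (Ideal.pow_right_mono hJ _ hp)
    rw [pow_one, Ideal.span_singleton_pow] at h1
    obtain ⟨c, hc⟩ := mem_sup_span_singleton_iff.1 h1
    have := J.add_mem (J.mul_mem_left x hc) (J.mul_mem_left c hM)
    convert this using 1; ring

end Saturation

/-! ### The two main arguments: injectivity, then surjectivity. -/

section HyperplaneSection

variable {n d : ℕ} {f : MvPolynomial (Fin (n + 1)) ℂ}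
  {ℓ : Module.Dual ℂ (Fin (n + 1) → ℂ)}

theorem map_jacobianIdeal {m k : ℕ} (φ : MvPolynomial (Fin m) ℂ →ₐ[ℂ] MvPolynomial (Fin k) ℂ)
    {ι : Type*} (q : ι → MvPolynomial (Fin m) ℂ) :
    (Ideal.span (Set.range q)).map φ = Ideal.span (Set.range fun i => φ (q i)) := by
  rw [Ideal.map_span, ← Set.range_comp]
  rfl

/-- Multiplication by `ℓ` is injective on the Milnor algebra in low degrees. -/
theorem mem_jacobianIdeal_of_linearForm_mul_mem (hd : 2 ≤ d) (hf : f.IsHomogeneous d)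
    (hℓ : ℓ ≠ 0) (hH : hyperplane ℓ ∩ singularLocus f = ∅)
    (b : Module.Basis (Fin n) ℂ (LinearMap.ker ℓ)) {k : ℕ}
    (hr : k + 3 ≤ d + r (restrict b f)) (hs : k + 3 ≤ d + s (restrict b f))
    {p : MvPolynomial (Fin (n + 1)) ℂ} (hp : p.IsHomogeneous k)
    (h : linearForm ℓ * p ∈ jacobianIdeal f) : p ∈ jacobianIdeal f := by
  obtain ⟨v, φ, -, hv⟩ := exists_dual_decomposition hℓ b
  have hlp := (linearForm_isHomogeneous ℓ).mul hp
  have hl0 := linearForm_ne_zero hℓ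
  -- Below degree d - 1 the ideal J(f) is zero. Otherwise the coefficients have degree i = k + 2 -
  -- d, which the hypotheses make smaller than both r(g) and s(g).
  rcases lt_or_ge (1 + k) (d - 1) with hlt | hge
  · have h1 := eq_zero_of_mem_span_of_lt (fun i => hf.pderiv) hlp h hlt
    rw [(mul_eq_zero.1 h1).resolve_left hl0]
    exact zero_mem _
  obtain ⟨i, hi⟩ := Nat.exists_eq_add_of_le' hge
  rw [hi] at hlp
  have hJ := jacobianIdeal_eq_span (f := f) hv
  set G : Fin (n + 1) → MvPolynomial (Fin (n + 1)) ℂ :=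
    Fin.cons (dirDeriv f v) fun j => dirDeriv f (b j) with hG
  have hGh : ∀ j, (G j).IsHomogeneous (d - 1) := by
    intro j
    induction j using Fin.cases with
    | zero => exact isHomogeneous_dirDeriv hf _
    | succ j => exact isHomogeneous_dirDeriv hf _
  have hGs : ∀ j, restrict b (G (Fin.succ j)) = pderiv j (restrict b f) := fun j =>
    (pderiv_restrict b f j).symm
  rw [hJ] at h ⊢
  obtain ⟨a, ha, hap⟩ := exists_isHomogeneous_of_mem_span hGh hlp h
  have hres := congrArg (restrict b) hap
  rw [map_mul, restrict_linearForm_self, zero_mul, map_sum, Fin.sum_univ_succ] at hres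
  simp only [map_mul, hGs] at hres
  have hJg : ∀ c : Fin n → MvPolynomial (Fin n) ℂ,
      ∑ j, c j * pderiv j (restrict b f) ∈ jacobianIdeal (restrict b f) := fun c =>
    Ideal.sum_mem _ fun j _ => Ideal.mul_mem_left _ _ (Ideal.subset_span ⟨j, rfl⟩)
  have ha0 : restrict b (a 0) = 0 := by
    by_contra hne
    -- A power of the irrelevant ideal lies in the ideal generated by f_v| and the g_j, and a₀|
    -- multiplies each of these into J(g).
    have hsat : restrict b (a 0) ∈ saturatedJacobianIdeal (restrict b f) := by
      obtain ⟨N, hN⟩ := exists_pow_idealOfVars_le fun y hy =>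
        eq_zero_of_eval_restrict_pderiv (by omega) hf hH b (y := y) hy
      refine (mem_saturation_iff _ _).2 ⟨N, fun z hz => ?_⟩
      have hz' := hN hz
      rw [← map_jacobianIdeal (restrict b) fun i => pderiv i f] at hz'
      change z ∈ (jacobianIdeal f).map (restrict b) at hz'
      rw [hJ, map_jacobianIdeal] at hz'
      obtain ⟨c, rfl⟩ := Ideal.mem_span_range_iff_exists_fun.1 hz'
      rw [Fin.sum_univ_succ, mul_add]
      simp only [hGs]
      refine Ideal.add_mem _ ?_ (Ideal.mul_mem_left _ _ (hJg _))
      have h1 : restrict b (a 0) * (c 0 * restrict b (G 0)) =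
          -(c 0 * ∑ j, restrict b (a (Fin.succ j)) * pderiv j (restrict b f)) := by
        linear_combination c 0 * hres
      rw [h1]
      exact neg_mem (Ideal.mul_mem_left _ _ (hJg _))
    have := Nat.sInf_le (show i ∈ {j | ∃ p ∈ saturatedJacobianIdeal (restrict b f),
      p.IsHomogeneous j ∧ p ≠ 0} from ⟨_, hsat, isHomogeneous_restrict b (ha 0), hne⟩)
    change s (restrict b f) ≤ i at this
    omega
  have has : ∀ j : Fin n, restrict b (a (Fin.succ j)) = 0 := by
    by_contra! hne
    obtain ⟨j, hj⟩ := hne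
    rw [ha0, zero_mul, zero_add] at hres
    have := Nat.sInf_le (show i ∈ {j | ∃ a ∈ syz (restrict b f),
      (∀ i, (a i).IsHomogeneous j) ∧ a ≠ 0} from
      ⟨fun j => restrict b (a (Fin.succ j)), (mem_syz_iff _ _).2 hres,
        fun j => isHomogeneous_restrict b (ha _), fun h => hj (congrFun h j)⟩)
    change r (restrict b f) ≤ i at this
    omega
  have hdvd : ∀ j, ∃ c, c * linearForm ℓ = a j := by
    intro j
    refine Ideal.mem_span_singleton'.1 (mem_span_of_restrict_eq_zero (b := b) hℓ ?_)
    induction j using Fin.cases with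
    | zero => exact ha0
    | succ j => exact has j
  choose c hc using hdvd
  refine Ideal.mem_span_range_iff_exists_fun.2 ⟨c, mul_left_cancel₀ hl0 ?_⟩
  rw [← hap, Finset.mul_sum]
  exact Finset.sum_congr rfl fun j _ => by rw [← hc]; ring

/-- Multiplication by `ℓ` is surjective on the Jacobian module in high degrees. -/
theorem exists_sub_linearForm_mul_mem (hd : 2 ≤ d) (hf : f.IsHomogeneous d)
    (hℓ : ℓ ≠ 0) (hH : hyperplane ℓ ∩ singularLocus f = ∅)
    (b : Module.Basis (Fin n) ℂ (LinearMap.ker ℓ)) {k : ℕ}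
    (hr : n * (d - 2) + (d - 2) + 2 ≤ k + (d + r (restrict b f)))
    (hs : n * (d - 2) + (d - 2) + 2 ≤ k + (d + s (restrict b f)))
    {c : MvPolynomial (Fin (n + 1)) ℂ} (hc : c.IsHomogeneous (k + 1))
    (hcI : c ∈ saturatedJacobianIdeal f) :
    ∃ c' ∈ saturatedJacobianIdeal f, c'.IsHomogeneous k ∧
      c - linearForm ℓ * c' ∈ jacobianIdeal f := by
  obtain ⟨i₀, t, hq'⟩ := exists_isParameterSystem_sub (e := d - 1) (by omega)
    (fun i => isHomogeneous_restrict b (hf.pderiv (i := i)))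
    (fun y hy => eq_zero_of_eval_restrict_pderiv (by omega) hf hH b hy)
  set p := pderiv i₀ f with hp
  set q : Fin n → MvPolynomial (Fin (n + 1)) ℂ :=
    fun j => pderiv (i₀.succAbove j) f - C (t j) * p with hq
  set Q := Ideal.span (Set.range q) with hQ
  set l := linearForm ℓ with hl
  have hph : p.IsHomogeneous (d - 1) := hf.pderiv
  have hqh : ∀ j, (q j).IsHomogeneous (d - 1) := fun j => by
    refine hf.pderiv.sub ?_
    simpa using (isHomogeneous_C (Fin (n + 1)) (t j)).mul hph
  have hqr : (fun j => restrict b (q j)) = fun j =>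
      restrict b (pderiv (i₀.succAbove j) f) - C (t j) * restrict b p := by
    ext1 j
    simp [hq, restrict, algebraMap_eq]
  rw [← hqr] at hq'
  have hQmap : Q.map (restrict b) = Ideal.span (Set.range fun j => restrict b (q j)) :=
    map_jacobianIdeal _ _
  have hJ : jacobianIdeal f = Q ⊔ Ideal.span {p} := by
    apply le_antisymm
    · refine Ideal.span_le.2 ?_
      rintro _ ⟨i, rfl⟩
      induction i using Fin.succAboveCases i₀ with
      | x => exact Ideal.mem_sup_right (Ideal.mem_span_singleton_self _)
      | p j =>
        refine mem_sup_span_singleton_iff.2 ⟨C (t j), Ideal.subset_span ⟨j, ?_⟩⟩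
        simp [hq, mul_comm]
    · have h1 : ∀ i, pderiv i f ∈ jacobianIdeal f := fun i => Ideal.subset_span ⟨i, rfl⟩
      refine sup_le (Ideal.span_le.2 ?_) ((Ideal.span_singleton_le_iff_mem _).2 (h1 i₀))
      rintro _ ⟨j, rfl⟩
      exact sub_mem (h1 _) (Ideal.mul_mem_left _ _ (h1 i₀))
  have hlh := linearForm_isHomogeneous ℓ
  have hlm : l ∈ irrelevantIdeal (n + 1) := by
    rw [← pow_one (irrelevantIdeal (n + 1))]
    exact mem_idealOfVars_pow_of_isHomogeneous hlh le_rfl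
  obtain ⟨N, hN⟩ : ∃ N, irrelevantIdeal (n + 1) ^ N ≤ Q ⊔ Ideal.span {l} := by
    obtain ⟨N, hN⟩ := hq'.exists_pow_le
    refine ⟨N, fun x hx => mem_sup_of_restrict_mem (b := b) hℓ ?_⟩
    rw [hQmap]
    refine hN ?_
    have h1 : (irrelevantIdeal (n + 1)).map (restrict b) ≤ idealOfVars (Fin n) ℂ := by
      rw [irrelevantIdeal, Ideal.map_span, Ideal.span_le]
      rintro _ ⟨_, ⟨i, rfl⟩, rfl⟩
      rw [SetLike.mem_coe, ← pow_one (idealOfVars (Fin n) ℂ)]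
      exact mem_idealOfVars_pow_of_isHomogeneous
        (isHomogeneous_restrict b (isHomogeneous_X ℂ i)) le_rfl
    have h2 := Ideal.mem_map_of_mem (restrict b) hx
    rw [Ideal.map_pow] at h2
    exact Ideal.pow_right_mono h1 N h2
  have hlQ : IsRegularMod Q l := by
    -- Together, l and the q_j form a parameter system upstairs, so l is regular modulo Q.
    have hsys : IsParameterSystem (Fin.cons 1 fun _ : Fin n => d - 1 : Fin (n + 1) → ℕ)
        (Fin.cons l q : Fin (n + 1) → MvPolynomial (Fin (n + 1)) ℂ) := by
      refine ⟨fun j => ?_, fun j => ?_, N, ?_⟩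
      · induction j using Fin.cases with
        | zero => simp
        | succ j => simp; omega
      · induction j using Fin.cases with
        | zero => exact hlh
        | succ j => exact hqh j
      · refine hN.trans (le_of_eq ?_)
        rw [Fin.range_cons, Set.insert_eq, Ideal.span_union, sup_comm]
    have h1 := hsys.isGorensteinFamily.regular (Set.range Fin.succ) 0 (by simp)
    rwa [← Set.range_comp, Fin.cons_zero,
      show (Fin.cons l q : Fin (n + 1) → _) ∘ Fin.succ = q from rfl] at h1
  have hsat : ∀ x, x ∈ saturatedJacobianIdeal f ↔ ∃ M, l ^ M * x ∈ jacobianIdeal f := fun x =>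
    mem_saturation_iff_exists_pow_mul_mem hlm
      (hN.trans (sup_le_sup_right (hJ ▸ le_sup_left) _))
  obtain ⟨M, hM⟩ := (hsat c).1 hcI
  have hQh : Q.IsHomogeneous (homogeneousSubmodule (Fin (n + 1)) ℂ) :=
    isHomogeneous_span (by rintro _ ⟨j, rfl⟩; exact ⟨_, hqh j⟩)
  have hdual : restrict b c ∈ Ideal.span (Set.range fun j => restrict b (q j)) ⊔
      Ideal.span {restrict b p} := by
    refine hq'.mem_sup_of_forall_mul_mem (isHomogeneous_restrict b hph)
      (isHomogeneous_restrict b hc) fun i u hi hu hpu => ?_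
    rw [Finset.sum_const, Finset.card_univ, Fintype.card_fin, smul_eq_mul,
      show d - 1 - 1 = d - 2 by omega] at hi
    obtain ⟨U, hU, rfl⟩ := exists_restrict_eq (b := b) hℓ hu
    rw [← map_mul, ← hQmap] at hpu
    obtain ⟨w, hw⟩ := mem_sup_span_singleton_iff.1 (mem_sup_of_restrict_mem hℓ hpu)
    have hpU : (p * U).IsHomogeneous (i + (d - 2) + 1) := by
      convert hph.mul hU using 1; omega
    have hw1 := homogeneousComponent_mem_of_mem hQh hw (i + (d - 2) + 1)
    rw [map_sub, homogeneousComponent_eq_self hpU, mul_comm l w,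
      homogeneousComponent_add_mul hlh] at hw1
    -- From pU ≡ lw mod Q, injectivity gives w ≡ py mod Q. Thus U can be corrected to U - ly, which
    -- has the same restriction and satisfies p(U - ly) ∈ Q. Since l^M c ≡ pz mod Q, regularity of l
    -- gives c(U - ly) ∈ Q. The degree i + d - 2 equals (n+1)(d-2) - k - 1, complementary to k + 1.
    have hw2 : homogeneousComponent (i + (d - 2)) w ∈ jacobianIdeal f := by
      refine mem_jacobianIdeal_of_linearForm_mul_mem hd hf hℓ hH b (k := i + (d - 2))
        (by omega) (by omega) (homogeneousComponent_isHomogeneous _ _) ?_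
      rw [hJ]
      refine mem_sup_span_singleton_iff.2 ⟨U, ?_⟩
      have := Q.neg_mem hw1
      convert this using 1; ring
    rw [hJ] at hw2 hM
    obtain ⟨y, hy⟩ := mem_sup_span_singleton_iff.1 hw2
    obtain ⟨z, hz⟩ := mem_sup_span_singleton_iff.1 hM
    have h1 : p * (U - l * y) ∈ Q := by
      have := Q.add_mem hw1 (Q.mul_mem_left l hy)
      convert this using 1; ring
    have h2 : c * (U - l * y) ∈ Q := by
      refine hlQ.pow M _ ?_
      have := Q.add_mem (Q.mul_mem_left (U - l * y) hz) (Q.mul_mem_left z h1)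
      convert this using 1; ring
    have h3 := Ideal.mem_map_of_mem (restrict b) h2
    rw [hQmap, map_mul, map_sub, map_mul, hl, restrict_linearForm_self, zero_mul, sub_zero] at h3
    exact h3
  have hcJ : c ∈ jacobianIdeal f ⊔ Ideal.span {l} := by
    refine mem_sup_of_restrict_mem (b := b) hℓ ?_
    rw [hJ, Ideal.map_sup, hQmap, Ideal.map_span, Set.image_singleton]
    exact hdual
  obtain ⟨w, hw⟩ := mem_sup_span_singleton_iff.1 hcJ
  have hJh : (jacobianIdeal f).IsHomogeneous (homogeneousSubmodule (Fin (n + 1)) ℂ) :=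
    isHomogeneous_span (by rintro _ ⟨j, rfl⟩; exact ⟨_, hf.pderiv⟩)
  have hw1 := homogeneousComponent_mem_of_mem hJh hw (k + 1)
  rw [map_sub, homogeneousComponent_eq_self hc, mul_comm l w, homogeneousComponent_add_mul hlh,
    mul_comm _ (linearForm ℓ)] at hw1
  refine ⟨_, (hsat _).2 ⟨M + 1, ?_⟩, homogeneousComponent_isHomogeneous k w, hw1⟩
  -- The quotient c' is again in I(f): l^(M+1) c' differs from l^M c by an element of J(f).
  have := (jacobianIdeal f).sub_mem hM ((jacobianIdeal f).mul_mem_left (l ^ M) hw1)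
  convert this using 1; ring

end HyperplaneSection

/-! ### Translation from polynomials to the graded pieces of N(f). -/

section MulMap

variable {m : ℕ} {f : MvPolynomial (Fin m) ℂ} {ℓ : Module.Dual ℂ (Fin m → ℂ)} {k : ℕ}

theorem mulMap_injective (h : ∀ p : MvPolynomial (Fin m) ℂ, p.IsHomogeneous k →
    linearForm ℓ * p ∈ jacobianIdeal f → p ∈ jacobianIdeal f) :
    Function.Injective (mulMap f ℓ k) := by
  refine (injective_iff_map_eq_zero _).2 ?_
  rintro ⟨_, q, hq, rfl⟩ h0
  have h1 : ((jacobianIdeal f).submoduleOf (saturatedJacobianIdeal f)).mkQ (linearForm ℓ • q) = 0 :=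
    congrArg Subtype.val h0
  rw [Submodule.mkQ_apply, Submodule.Quotient.mk_eq_zero] at h1
  exact Subtype.ext ((Submodule.Quotient.mk_eq_zero _).2 (h q hq h1))

theorem mulMap_surjective (h : ∀ c ∈ saturatedJacobianIdeal f, c.IsHomogeneous (k + 1) →
    ∃ c' ∈ saturatedJacobianIdeal f, c'.IsHomogeneous k ∧
      c - linearForm ℓ * c' ∈ jacobianIdeal f) :
    Function.Surjective (mulMap f ℓ k) := by
  rintro ⟨_, c, hc, rfl⟩
  obtain ⟨c', hc', hk, hcc'⟩ := h c c.2 hc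
  refine ⟨⟨_, ⟨c', hc'⟩, hk, rfl⟩, Subtype.ext ?_⟩
  refine Eq.symm ((Submodule.Quotient.eq
    ((jacobianIdeal f).submoduleOf (saturatedJacobianIdeal f))).2 ?_)
  exact hcc'

end MulMap

end JacobianModule

theorem corollary1p12 (n d : ℕ) (hn : 3 ≤ n) (hd : 3 ≤ d)
    (f : MvPolynomial (Fin (n + 1)) ℂ) (hf0 : f ≠ 0) (hf : f.IsHomogeneous d)
    (ℓ : Module.Dual ℂ (Fin (n + 1) → ℂ)) (hℓ : ℓ ≠ 0)
    (hH : JacobianModule.hyperplane ℓ ∩ JacobianModule.singularLocus f = ∅)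
    (b : Module.Basis (Fin n) ℂ (LinearMap.ker ℓ))
    (g : MvPolynomial (Fin n) ℂ) (hg : g = JacobianModule.hyperplaneSection f ℓ b)
    (hsing : (JacobianModule.singularLocus g).Nonempty)
    (k₀ : ℤ) (hk₀ : k₀ = min ((d : ℤ) - 3 + JacobianModule.r g) ((d : ℤ) - 3 + JacobianModule.s g)) :
    (∀ k : ℕ, (k : ℤ) ≤ k₀ → Function.Injective (JacobianModule.mulMap f ℓ k)) ∧
    (∀ k : ℕ, ((n : ℤ) + 1) * ((d : ℤ) - 2) - k₀ ≤ (k : ℤ) →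
      Function.Surjective (JacobianModule.mulMap f ℓ k)) := by
  obtain rfl : g = JacobianModule.restrict b f := hg
  refine ⟨fun k hk => JacobianModule.mulMap_injective fun p hp =>
    JacobianModule.mem_jacobianIdeal_of_linearForm_mul_mem (by omega) hf hℓ hH b
      (by omega) (by omega) hp, fun k hk => JacobianModule.mulMap_surjective fun c hc hck => ?_⟩
  have hT : ((n : ℤ) + 1) * ((d : ℤ) - 2) = ((n * (d - 2) + (d - 2) : ℕ) : ℤ) := by
    rw [Nat.cast_add, Nat.cast_mul, Nat.cast_sub (by omega)]
    push_cast
    ring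
  rw [hT] at hk
  -- One degree is to spare: the dual map starts in degree (n+1)(d-2) - k - 1, so k ≥ (n+1)(d-2) -
  -- k₀ - 1 would suffice.
  exact JacobianModule.exists_sub_linearForm_mul_mem (by omega) hf hℓ hH b
    (by omega) (by omega) hck hc
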